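/- **Theorem 3.2.** On $L^2(\mathbb R)$ let $q$ be multiplication by $x$, $p=-i\,d/dx$, $\mathsf a=\frac1{\sqrt2}(q+ip)$, $\mathsf a^*=\frac1{\sqrt2}(q-ip)$. Let $|0\rangle=\pi^{-1/4}e^{-x^2/2}$ and $\mathsf a^*|n\rangle=\sqrt{n+1}\,|n+1\rangle$, so that $\{|n\rangle:n\in\mathbb N_0\}$ is the orthonormal Hermite basis of $L^2(\mathbb R)$. For $z\in\mathbb C$ let $\mathcal W_z=\exp\!\big(\tfrac{i}{\sqrt2}(\bar z\,\mathsf a+z\,\mathsf a^*)\big)$ be the Weyl operator; for a trace class operator $\rho$ put $\langle\mathcal W_z\rangle_\rho=\operatorname{Tr}(\mathcal W_z\rho)$, and put $\langle\mathcal W_z\rangle_\ell=\langle \ell|\mathcal W_z|\ell\rangle$. Let $L_\ell(x)=\sum_{n=0}^{\ell}\frac{(-1)^nx^n}{n!}\binom{\ell}{n}$, and let $\|\rho\|_1=\operatorname{Tr}|\rho|$ be the trace norm. For every real $a>0$ and every $\ell\in\mathbb N_0$ there is a unique self-adjoint trace class operator $\rho_a^{(\ell)}$ on $L^2(\mathbb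 R)$ such that $$\langle\mathcal W_z\rangle_{\rho_a^{(\ell)}}=\langle\mathcal W_{\sqrt a\,z}\rangle_{\ell}=L_\ell\Big(\frac{a|z|^2}{2}\Big)e^{-\frac14a|z|^2}\qquad\text{for all }z\in\mathbb C.$$ It is the (unique) bounded operator on $L^2(\mathbb R)$ with $$\rho_a^{(\ell)}|n\rangle=\sum_{j=0}^{\ell}\sigma_{j,\ell}(\zeta_a)\,\omega_{n,j,\ell}(\zeta_a)\,|n\rangle\quad\text{for all }n\in\mathbb N_0,\qquad \zeta_a=\frac{a-1}{a+1},$$ where, for $0\le j\le\ell$ and $x\in\mathbb R$, $\sigma_{j,\ell}(x)=\binom{\ell}{j}(-x)^j(1+x)^{\ell-j}$, and $\omega_{n,j,\ell}(x)=\binom{n}{\ell-j}x^{n-(\ell-j)}(1-x)^{\ell-j+1}$ if $n\ge\ell-j$, and $\omega_{n,j,\ell}(x)=0$ otherwise (with $0^0=1$). Moreover, $$\|\rho_a^{(\ell)}\|_1\le\begin{cases}a^{\ell}&\text{if }a\ge1,\\(1/a)^{\ell+1}&\text{if }a<1.\end{cases}$$ -/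

import Mathlib

open MeasureTheory Filter Topology
open scoped ENNReal SchwartzMap ComplexConjugate InnerProductSpace

/-! ## Trace class operators on a complex Hilbert space -/

section TraceClass

variable {H : Type*} [NormedAddCommGroup H] [InnerProductSpace ℂ H] [CompleteSpace H]

/-- The index set of a fixed orthonormal (Hilbert) basis of `H`. -/
noncomputable def onbIndex (H : Type*) [NormedAddCommGroup H] [InnerProductSpace ℂ H]
    [CompleteSpace H] : Set H :=
  (exists_hilbertBasis ℂ H).choose

/-- A fixed orthonormal (Hilbert) basis of `H`; the quantities below do not depend on it. -/
noncomputable def onb (H : Type*) [NormedAddCommGroup H] [InnerProductSpace ℂ H]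
    [CompleteSpace H] : HilbertBasis (onbIndex H) ℂ H :=
  (exists_hilbertBasis ℂ H).choose_spec.choose

/-- The trace norm `‖T‖₁ = Tr |T| = ∑ ⟨eᵢ, |T| eᵢ⟩`, where `|T| = (T* T)^{1/2}`. -/
noncomputable def traceNorm (T : H →L[ℂ] H) : ℝ≥0∞ :=
  ∑' i, ENNReal.ofReal (RCLike.re (inner ℂ (onb H i) (CFC.abs T (onb H i))))

/-- `T` is a trace class operator. -/
def IsTraceClass (T : H →L[ℂ] H) : Prop := traceNorm T < ∞

/-- The trace `Tr T = ∑ ⟨eᵢ, T eᵢ⟩`; the series converges absolutely if `T` is trace class. -/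
noncomputable def opTrace (T : H →L[ℂ] H) : ℂ :=
  ∑' i, inner ℂ (onb H i) (T (onb H i))

end TraceClass

/-! ## Position, momentum, creation and annihilation operators on Schwartz space -/

/-- The Hilbert space `L²(ℝ)` of complex valued functions. -/
abbrev L2R : Type := Lp ℂ 2 (volume : Measure ℝ)

/-- The position operator: multiplication by the variable. -/
noncomputable def positionOp : 𝓢(ℝ, ℂ) →L[ℂ] 𝓢(ℝ, ℂ) :=
  SchwartzMap.smulLeftCLM ℂ (fun x : ℝ => (x : ℂ))

/-- The momentum operator `p = -i d/dx`. -/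
noncomputable def momentumOp : 𝓢(ℝ, ℂ) →L[ℂ] 𝓢(ℝ, ℂ) :=
  (-Complex.I) • SchwartzMap.derivCLM ℂ ℂ

/-- The annihilation operator `a = (q + i p) / √2`. -/
noncomputable def annihilationOp : 𝓢(ℝ, ℂ) →L[ℂ] 𝓢(ℝ, ℂ) :=
  (1 / (Real.sqrt 2 : ℂ)) • (positionOp + Complex.I • momentumOp)

/-- The creation operator `a* = (q - i p) / √2`. -/
noncomputable def creationOp : 𝓢(ℝ, ℂ) →L[ℂ] 𝓢(ℝ, ℂ) :=
  (1 / (Real.sqrt 2 : ℂ)) • (positionOp - Complex.I • momentumOp)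

theorem positionOp_apply (f : 𝓢(ℝ, ℂ)) (x : ℝ) : positionOp f x = x * f x := by
  have h : (fun x : ℝ => (x : ℂ)).HasTemperateGrowth :=
    Complex.ofRealCLM.hasTemperateGrowth
  rw [positionOp, SchwartzMap.smulLeftCLM_apply_apply h, smul_eq_mul]

theorem momentumOp_apply (f : 𝓢(ℝ, ℂ)) (x : ℝ) :
    momentumOp f x = -Complex.I * deriv f x := by
  simp [momentumOp]

/-! ## The Hermite functions -/

theorem gaussian_decay (k n : ℕ) : ∃ C, ∀ x : ℝ,
    ‖x‖ ^ k * ‖iteratedFDeriv ℝ n (fun y : ℝ => Real.exp (-(y ^ 2 / 2))) x‖ ≤ C := by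
  -- the derivatives are polynomials times the Gaussian
  let Q : Polynomial ℝ := Polynomial.X ^ k * (Polynomial.hermite n).map (Int.castRingHom ℝ)
  have hQ : Tendsto (fun x : ℝ => Q.eval x * Real.exp (-(x ^ 2 / 2))) (cocompact ℝ) (𝓝 0) := by
    have h := tendsto_rpow_abs_mul_exp_neg_mul_sq_cocompact (a := 1 / 2) (by norm_num)
    have h2 : ∀ p : Polynomial ℝ,
        Tendsto (fun x : ℝ => p.eval x * Real.exp (-(x ^ 2 / 2))) (cocompact ℝ) (𝓝 0) := by
      intro p
      induction p using Polynomial.induction_on' with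
      | add p q hp hq => simpa [add_mul] using hp.add hq
      | monomial m c =>
        rw [tendsto_zero_iff_norm_tendsto_zero]
        have h3 := (h m).const_mul |c|
        rw [mul_zero] at h3
        refine h3.congr fun x => ?_
        rw [Polynomial.eval_monomial, norm_mul, norm_mul, norm_pow, Real.norm_eq_abs,
          Real.norm_eq_abs, Real.norm_eq_abs, Real.abs_exp, Real.rpow_natCast, mul_assoc]
        ring_nf
    exact h2 Q
  have hcont : Continuous fun x : ℝ => Q.eval x * Real.exp (-(x ^ 2 / 2)) :=
    Q.continuous.mul (by fun_prop)
  obtain ⟨C, hC⟩ := (ZeroAtInftyContinuousMap.mk ⟨_, hcont⟩ hQ :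
    ZeroAtInftyContinuousMap ℝ ℝ).isBounded_range.exists_norm_le
  refine ⟨C, fun x => ?_⟩
  have := hC _ ⟨x, rfl⟩
  refine le_trans (le_of_eq ?_) this
  rw [norm_iteratedFDeriv_eq_norm_iteratedDeriv, iteratedDeriv_eq_iterate,
    Polynomial.deriv_gaussian_eq_hermite_mul_gaussian]
  simp [Q, Polynomial.aeval_def, Polynomial.eval_map, mul_assoc]

/-- The function `x ↦ exp (-x² / 2)` as a Schwartz function. -/
noncomputable def gaussianSchwartz : 𝓢(ℝ, ℝ) where
  toFun := fun x => Real.exp (-(x ^ 2 / 2))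
  smooth' := by fun_prop
  decay' := gaussian_decay

/-- The normalized eigenfunctions of the harmonic oscillator `a* a + 1/2` as Schwartz functions:
`|0⟩ = π^{-1/4} exp (-x² / 2)` and `a* |n⟩ = √(n+1) |n+1⟩`. -/
noncomputable def hermiteSchwartz : ℕ → 𝓢(ℝ, ℂ)
  | 0 => ((Real.pi ^ (-(1 / 4) : ℝ) : ℝ) : ℂ) •
      SchwartzMap.postcompCLM (𝕜 := ℝ) Complex.ofRealCLM gaussianSchwartz
  | n + 1 => (1 / (Real.sqrt (n + 1) : ℂ)) • creationOp (hermiteSchwartz n)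

/-- The vector `|n⟩` of `L²(ℝ)`. -/
noncomputable def hermiteVec (n : ℕ) : L2R := (hermiteSchwartz n).toLp 2 volume

/-! ## The Weyl operators -/

/-- The Weyl operator on functions: for `z = s + i t`,
`(W_z f)(x) = exp (i (s x + s t / 2)) f (x + t)`. -/
noncomputable def weylFun (z : ℂ) (f : ℝ → ℂ) (x : ℝ) : ℂ :=
  Complex.exp (Complex.I * ((z.re * x + z.re * z.im / 2 : ℝ) : ℂ)) * f (x + z.im)

theorem norm_weylFun (z : ℂ) (f : ℝ → ℂ) (x : ℝ) : ‖weylFun z f x‖ = ‖f (x + z.im)‖ := by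
  rw [weylFun, norm_mul, mul_comm Complex.I, Complex.norm_exp_ofReal_mul_I, one_mul]

theorem eLpNorm_weylFun (z : ℂ) (f : ℝ → ℂ) (hf : AEStronglyMeasurable f volume) :
    eLpNorm (weylFun z f) 2 volume = eLpNorm f 2 volume := by
  rw [← eLpNorm_comp_measurePreserving hf (measurePreserving_add_right volume z.im)]
  exact eLpNorm_congr_norm_ae (Eventually.of_forall fun x => norm_weylFun z f x)

theorem memLp_weylFun (z : ℂ) {f : ℝ → ℂ} (hf : MemLp f 2 volume) :
    MemLp (weylFun z f) 2 volume := by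
  refine ⟨?_, by rw [eLpNorm_weylFun z f hf.1]; exact hf.2⟩
  have h1 : AEStronglyMeasurable (fun x : ℝ => f (x + z.im)) volume :=
    hf.1.comp_measurePreserving (measurePreserving_add_right volume z.im)
  refine AEStronglyMeasurable.mul (Continuous.aestronglyMeasurable ?_) h1
  fun_prop

theorem weylFun_congr (z : ℂ) {f g : ℝ → ℂ} (h : f =ᵐ[volume] g) :
    weylFun z f =ᵐ[volume] weylFun z g := by
  have h1 := (measurePreserving_add_right (volume : Measure ℝ) z.im).quasiMeasurePreserving.ae_eq h
  filter_upwards [h1] with x hx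
  simp only [Function.comp_apply] at hx
  simp [weylFun, hx]

/-- The Weyl operator `W_z = exp ((i/√2) (z̄ a + z a*)) = exp (i (s q + t p))`, `z = s + i t`, on
`L²(ℝ)`, in its explicit (Schrödinger) form. That it is this exponential is `weyl_zero`,
`weyl_add`, `norm_weyl`, `continuous_weyl` and `hasDerivAt_weyl` below. -/
noncomputable def weyl (z : ℂ) : L2R →L[ℂ] L2R :=
  LinearMap.mkContinuous
    { toFun := fun f => (memLp_weylFun z (Lp.memLp f)).toLp (weylFun z f)
      map_add' := fun f g => by
        rw [← MemLp.toLp_add, MemLp.toLp_eq_toLp_iff]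
        refine (weylFun_congr z (Lp.coeFn_add f g)).trans (Eventually.of_forall fun x => ?_)
        simp [weylFun, mul_add]
      map_smul' := fun c f => by
        rw [RingHom.id_apply, ← MemLp.toLp_const_smul, MemLp.toLp_eq_toLp_iff]
        refine (weylFun_congr z (Lp.coeFn_smul c f)).trans (Eventually.of_forall fun x => ?_)
        simp [weylFun, mul_left_comm] }
    1 (fun f => by
      simp only [LinearMap.coe_mk, AddHom.coe_mk, one_mul]
      rw [Lp.norm_toLp, eLpNorm_weylFun z f (Lp.aestronglyMeasurable f), Lp.norm_def])

theorem coeFn_weyl (z : ℂ) (f : L2R) : weyl z f =ᵐ[volume] weylFun z f :=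
  MemLp.coeFn_toLp (memLp_weylFun z (Lp.memLp f))

theorem norm_weyl (z : ℂ) (f : L2R) : ‖weyl z f‖ = ‖f‖ := by
  change ‖(memLp_weylFun z (Lp.memLp f)).toLp (weylFun z f)‖ = _
  rw [Lp.norm_toLp, eLpNorm_weylFun z f (Lp.aestronglyMeasurable f), Lp.norm_def]

theorem weyl_zero : weyl 0 = 1 := by
  ext1 f
  apply Lp.ext
  filter_upwards [coeFn_weyl 0 f] with x hx
  rw [hx]
  simp [weylFun]

/-- For fixed `z`, `s ↦ W_{s z}` is a one-parameter group. -/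
theorem weyl_add (z : ℂ) (s t : ℝ) :
    weyl (((s + t : ℝ) : ℂ) * z) = weyl (s * z) ∘L weyl (t * z) := by
  ext1 f
  apply Lp.ext
  filter_upwards [coeFn_weyl (((s + t : ℝ) : ℂ) * z) f, coeFn_weyl (s * z) (weyl (t * z) f),
    weylFun_congr (s * z) (coeFn_weyl (t * z) f)] with x h1 h2 h3
  rw [ContinuousLinearMap.comp_apply, h1, h2, h3]
  simp only [weylFun, Complex.re_ofReal_mul, Complex.im_ofReal_mul, ← mul_assoc,
    ← Complex.exp_add]
  congr 2
  · push_cast; ring_nf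
  · ring_nf

/-- The exponent of the Weyl operator, up to the factor `i`: `(z̄ a + z a*) / √2`. -/
noncomputable def weylExponent (z : ℂ) : 𝓢(ℝ, ℂ) →L[ℂ] 𝓢(ℝ, ℂ) :=
  (1 / (Real.sqrt 2 : ℂ)) • (conj z • annihilationOp + z • creationOp)

theorem weylExponent_apply (z : ℂ) (f : 𝓢(ℝ, ℂ)) (x : ℝ) :
    weylExponent z f x = z.re * (x * f x) - Complex.I * (z.im * deriv f x) := by
  have h2 : (1 / (Real.sqrt 2 : ℂ)) * (1 / (Real.sqrt 2 : ℂ)) = 1 / 2 := by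
    rw [div_mul_div_comm, ← Complex.ofReal_mul, Real.mul_self_sqrt (by norm_num)]
    norm_num
  have hz : conj z = z.re - z.im * Complex.I := by
    apply Complex.ext <;> simp
  have key : weylExponent z f x = (1 / (Real.sqrt 2 : ℂ)) * (1 / (Real.sqrt 2 : ℂ)) *
      (conj z * (positionOp f x + Complex.I * momentumOp f x) +
        z * (positionOp f x - Complex.I * momentumOp f x)) := by
    simp [weylExponent, annihilationOp, creationOp]
    ring
  rw [key, h2, positionOp_apply, momentumOp_apply, hz]
  have hz' : z = z.re + z.im * Complex.I := (Complex.re_add_im z).symm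
  generalize z.re = u at *
  generalize z.im = v at *
  subst hz'
  linear_combination (v * Complex.I * deriv f x) * Complex.I_sq

theorem hasDerivAt_weylFun (z : ℂ) (f : 𝓢(ℝ, ℂ)) (s x : ℝ) :
    HasDerivAt (fun s : ℝ => weylFun (s * z) f x)
      (weylFun (s * z) (Complex.I • weylExponent z f) x) s := by
  have h1 : HasDerivAt (fun s : ℝ => f (x + s * z.im)) (z.im • deriv f (x + s * z.im)) s := by
    have hf : HasDerivAt f (deriv f (x + s * z.im)) (x + s * z.im) :=
      (f.differentiableAt).hasDerivAt
    have hg : HasDerivAt (fun s : ℝ => x + s * z.im) z.im s := by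
      simpa using ((hasDerivAt_id s).mul_const z.im).const_add x
    exact hf.scomp s hg
  have h2 : HasDerivAt (fun s : ℝ => s * z.re * x + (s * z.re) * (s * z.im) / 2)
      (z.re * (x + s * z.im)) s := by
    have h := (((hasDerivAt_id s).mul_const z.re).mul_const x).add
      ((((hasDerivAt_id s).mul_const z.re).mul ((hasDerivAt_id s).mul_const z.im)).div_const 2)
    refine h.congr_deriv ?_
    simp only [id]
    ring
  have h3 := ((h2.ofReal_comp.const_mul Complex.I).cexp).mul h1
  refine (h3.congr_deriv ?_).congr_of_eventuallyEq (Eventually.of_forall fun s => ?_)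
  · simp only [weylFun, Complex.re_ofReal_mul, Complex.im_ofReal_mul, Pi.smul_apply, smul_eq_mul,
      weylExponent_apply, Complex.real_smul]
    push_cast
    ring_nf
    simp only [Complex.I_sq]
    ring
  · simp [weylFun]

theorem weyl_decay (z : ℂ) (g : 𝓢(ℝ, ℂ)) : ∃ C : ℝ, ∀ s x : ℝ, |s| ≤ 1 →
    ‖weylFun (s * z) g x‖ ≤ C * (1 + x ^ 2)⁻¹ := by
  obtain ⟨C0, -, hC0⟩ := g.decay 0 0
  obtain ⟨C2, -, hC2⟩ := g.decay 2 0
  simp only [pow_zero, one_mul, norm_iteratedFDeriv_zero, Real.norm_eq_abs, sq_abs] at hC0 hC2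
  refine ⟨2 * (1 + z.im ^ 2) * (C0 + C2), fun s x hs => ?_⟩
  rw [norm_weylFun, ← div_eq_mul_inv, le_div_iff₀ (by positivity), Complex.im_ofReal_mul]
  set y := x + s * z.im with hy
  have h0 := hC0 y
  have h2 := hC2 y
  have hn := norm_nonneg (g y)
  have hw : (s * z.im) ^ 2 ≤ z.im ^ 2 := by
    rw [mul_pow]
    have : s ^ 2 ≤ 1 := (sq_le_one_iff_abs_le_one s).2 hs
    nlinarith [sq_nonneg z.im]
  have hx : 1 + x ^ 2 ≤ 2 * (1 + z.im ^ 2) * (1 + y ^ 2) := by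
    have : x = y - s * z.im := by rw [hy]; ring
    rw [this]
    nlinarith [sq_nonneg (y + s * z.im), mul_nonneg (sq_nonneg y) (sq_nonneg z.im)]
  calc ‖g y‖ * (1 + x ^ 2) ≤ ‖g y‖ * (2 * (1 + z.im ^ 2) * (1 + y ^ 2)) := by gcongr
    _ = 2 * (1 + z.im ^ 2) * (‖g y‖ + y ^ 2 * ‖g y‖) := by ring
    _ ≤ _ := by gcongr

theorem memLp_inv_one_add_sq : MemLp (fun x : ℝ => (1 + x ^ 2)⁻¹) 2 volume := by
  have hm : AEStronglyMeasurable (fun x : ℝ => (1 + x ^ 2)⁻¹) volume :=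
    integrable_inv_one_add_sq.1
  rw [memLp_two_iff_integrable_sq hm]
  refine integrable_inv_one_add_sq.mono' (hm.pow 2) (Eventually.of_forall fun x => ?_)
  have h1 : (1 + x ^ 2)⁻¹ ≤ 1 := inv_le_one_of_one_le₀ (by nlinarith [sq_nonneg x])
  have h0 : 0 ≤ (1 + x ^ 2)⁻¹ := by positivity
  rw [Real.norm_eq_abs, abs_of_nonneg (by positivity)]
  nlinarith

theorem weylFun_remainder (z : ℂ) (f g : 𝓢(ℝ, ℂ)) (hg : g = Complex.I • weylExponent z f)
    {C : ℝ} {s x : ℝ} (hs : |s| ≤ 1)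
    (hC : ∀ r : ℝ, |r| ≤ 1 → ‖weylFun (r * z) (Complex.I • weylExponent z g) x‖ ≤ C) :
    ‖weylFun (s * z) f x - f x - s * g x‖ ≤ s ^ 2 * C := by
  have hC0 : 0 ≤ C := (norm_nonneg _).trans (hC 0 (by simp))
  have e0 : ∀ h : 𝓢(ℝ, ℂ), weylFun (((0 : ℝ) : ℂ) * z) h x = h x := by
    intro h; simp [weylFun]
  have hin : ∀ r ∈ Set.Icc (-|s|) |s|, |r| ≤ |s| := fun r hr => abs_le.2 hr
  have h0 : (0 : ℝ) ∈ Set.Icc (-|s|) |s| := by simp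
  have hss : s ∈ Set.Icc (-|s|) |s| := abs_le.1 le_rfl
  have b1 : ∀ r ∈ Set.Icc (-|s|) |s|, ‖weylFun (r * z) g x - g x‖ ≤ C * |s| := by
    intro r hr
    have := (convex_Icc (-|s|) |s|).norm_image_sub_le_of_norm_hasDerivWithin_le
      (f := fun r : ℝ => weylFun (r * z) g x) (C := C)
      (fun t ht => (hasDerivAt_weylFun z g t x).hasDerivWithinAt)
      (fun t ht => hC t ((hin t ht).trans hs)) h0 hr
    rw [e0, sub_zero, Real.norm_eq_abs] at this
    exact this.trans (mul_le_mul_of_nonneg_left (hin r hr) hC0)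
  have b2 := (convex_Icc (-|s|) |s|).norm_image_sub_le_of_norm_hasDerivWithin_le
      (f := fun r : ℝ => weylFun (r * z) f x - r * g x)
      (f' := fun r : ℝ => weylFun (r * z) g x - g x) (C := C * |s|)
      (fun t ht => by
        have h := (hasDerivAt_weylFun z f t x).sub
          (((hasDerivAt_id t).ofReal_comp).mul_const (g x))
        refine (h.congr_deriv ?_).hasDerivWithinAt
        rw [hg]
        simp)
      b1 h0 hss
  rw [e0] at b2
  calc ‖weylFun (s * z) f x - f x - s * g x‖
      = ‖weylFun (s * z) f x - s * g x - (f x - ((0 : ℝ) : ℂ) * g x)‖ := by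
        congr 1; push_cast; ring
    _ ≤ C * |s| * ‖s - 0‖ := b2
    _ = s ^ 2 * C := by
        rw [sub_zero, Real.norm_eq_abs, mul_assoc, abs_mul_abs_self]; ring

theorem weyl_remainder (z : ℂ) (f g : 𝓢(ℝ, ℂ)) (hg : g = Complex.I • weylExponent z f) :
    ∃ D : ℝ, ∀ s : ℝ, |s| ≤ 1 →
      ‖weyl (s * z) (f.toLp 2 volume) - f.toLp 2 volume - s • g.toLp 2 volume‖ ≤ s ^ 2 * D := by
  obtain ⟨C, hC⟩ := weyl_decay z (Complex.I • weylExponent z g)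
  have hfin := (memLp_inv_one_add_sq.const_mul C).2.ne
  refine ⟨(eLpNorm (fun x : ℝ => C * (1 + x ^ 2)⁻¹) 2 volume).toReal, fun s hs => ?_⟩
  have hle : eLpNorm (weyl (s * z) (f.toLp 2 volume) - f.toLp 2 volume - s • g.toLp 2 volume : L2R)
      2 volume ≤ eLpNorm (s ^ 2 • fun x : ℝ => C * (1 + x ^ 2)⁻¹) 2 volume := by
    apply eLpNorm_mono_ae_real
    filter_upwards [Lp.coeFn_sub (weyl (s * z) (f.toLp 2 volume) - f.toLp 2 volume)
        (s • g.toLp 2 volume),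
      Lp.coeFn_sub (weyl (s * z) (f.toLp 2 volume)) (f.toLp 2 volume),
      Lp.coeFn_smul s (g.toLp 2 volume), coeFn_weyl (s * z) (f.toLp 2 volume),
      weylFun_congr (s * z) (f.coeFn_toLp 2 volume), f.coeFn_toLp 2 volume,
      g.coeFn_toLp 2 volume] with x h1 h2 h3 h4 h5 h6 h7
    rw [h1, Pi.sub_apply, h2, h3, Pi.sub_apply, Pi.smul_apply, h4, h5, h6, h7, Complex.real_smul]
    exact weylFun_remainder z f g hg hs fun r hr => hC r x hr
  rw [eLpNorm_const_smul] at hle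
  rw [Lp.norm_def]
  refine (ENNReal.toReal_mono (ENNReal.mul_ne_top (by simp) hfin) hle).trans (le_of_eq ?_)
  rw [ENNReal.toReal_mul]
  simp

/-- On Schwartz functions the group `s ↦ W_{s z}` solves `u' = (i/√2) (z̄ a + z a*) u` in
`L²(ℝ)`. -/
theorem hasDerivAt_weyl (z : ℂ) (f : 𝓢(ℝ, ℂ)) :
    HasDerivAt (fun s : ℝ => weyl (s * z) (f.toLp 2 volume))
      ((Complex.I • weylExponent z f).toLp 2 volume) 0 := by
  obtain ⟨D, hD⟩ := weyl_remainder z f _ rfl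
  rw [hasDerivAt_iff_isLittleO]
  refine (Asymptotics.IsBigO.of_bound (g := fun s : ℝ => s ^ 2) D ?_).trans_isLittleO ?_
  · filter_upwards [Metric.closedBall_mem_nhds (0 : ℝ) one_pos] with s hs
    rw [Metric.mem_closedBall, dist_zero_right, Real.norm_eq_abs] at hs
    have h := hD s hs
    rw [Complex.ofReal_zero, zero_mul, weyl_zero, one_apply_eq_self, sub_zero,
      Real.norm_eq_abs, abs_of_nonneg (sq_nonneg s), mul_comm D]
    exact h
  · simpa using Asymptotics.isLittleO_pow_id (𝕜 := ℝ) one_lt_two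

/-- For fixed `z`, the group `s ↦ W_{s z}` is strongly continuous. -/
theorem continuous_weyl (z : ℂ) (f : L2R) : Continuous fun s : ℝ => weyl (s * z) f := by
  have hmul : ∀ (t s : ℝ) (u : L2R), weyl (s * z) u = weyl (t * z) (weyl ((s - t : ℝ) * z) u) := by
    intro t s u
    rw [← ContinuousLinearMap.comp_apply, ← weyl_add, add_sub_cancel]
  have hzero : ContinuousAt (fun s : ℝ => weyl (s * z) f) 0 := by
    rw [Metric.continuousAt_iff]
    intro ε hε
    obtain ⟨h, hh⟩ := (SchwartzMap.denseRange_toLpCLM (E := ℝ) (F := ℂ) (μ := (volume : Measure ℝ))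
      (p := 2) ENNReal.ofNat_ne_top).exists_dist_lt f (show 0 < ε / 3 by positivity)
    obtain ⟨δ, hδ, hs⟩ := Metric.continuousAt_iff.1 (hasDerivAt_weyl z h).continuousAt (ε / 3)
      (by positivity)
    refine ⟨δ, hδ, fun {s} hsd => ?_⟩
    have h1 := hs hsd
    rw [dist_eq_norm] at h1 hh ⊢
    have hh : ‖f - h.toLp 2 volume‖ < ε / 3 := hh
    have h2 : ‖weyl (s * z) f - weyl (s * z) (h.toLp 2 volume)‖ < ε / 3 := by
      rw [← map_sub, norm_weyl]; exact hh
    have h3 : ‖weyl (((0 : ℝ) : ℂ) * z) (h.toLp 2 volume) - weyl (((0 : ℝ) : ℂ) * z) f‖ < ε / 3 := by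
      rw [← map_sub, norm_weyl, norm_sub_rev]; exact hh
    have := norm_add₃_le (a := weyl (s * z) f - weyl (s * z) (h.toLp 2 volume))
      (b := weyl (s * z) (h.toLp 2 volume) - weyl (((0 : ℝ) : ℂ) * z) (h.toLp 2 volume))
      (c := weyl (((0 : ℝ) : ℂ) * z) (h.toLp 2 volume) - weyl (((0 : ℝ) : ℂ) * z) f)
    rw [sub_add_sub_cancel, sub_add_sub_cancel] at this
    linarith
  rw [continuous_iff_continuousAt]
  intro t
  rw [show (fun s : ℝ => weyl (s * z) f) = fun s : ℝ => weyl (t * z) (weyl ((s - t : ℝ) * z) f) from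
    funext fun s => hmul t s f]
  refine (weyl (t * z)).continuous.continuousAt.comp ?_
  have hsub : ContinuousAt (fun s : ℝ => s - t) t := by fun_prop
  exact ContinuousAt.comp (f := fun s : ℝ => s - t) (g := fun s : ℝ => weyl (s * z) f)
    (by simpa using hzero) hsub

/-! ## The statement's explicit functions -/

/-- The Laguerre polynomial `L_k(x) = ∑_{n ≤ k} ((-1)ⁿ xⁿ / n!) (k choose n)`. -/
noncomputable def laguerreL (k : ℕ) (x : ℝ) : ℝ :=
  ∑ n ∈ Finset.range (k + 1), (-1) ^ n * x ^ n / (n.factorial : ℝ) * (k.choose n : ℝ)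

/-- `ζ_a = (a - 1) / (a + 1)`. -/
noncomputable def zetaOf (a : ℝ) : ℝ := (a - 1) / (a + 1)

/-- `σ_{j,ℓ}(x) = (ℓ choose j) (-x)^j (1 + x)^{ℓ-j}`. -/
noncomputable def sigmaWeight (j ℓ : ℕ) (x : ℝ) : ℝ :=
  (ℓ.choose j : ℝ) * (-x) ^ j * (1 + x) ^ (ℓ - j)

/-- `ω_{n,j,ℓ}(x) = (n choose ℓ-j) x^{n-(ℓ-j)} (1 - x)^{ℓ-j+1}` if `n ≥ ℓ - j`, and `0`
otherwise (for `j ≤ ℓ`). -/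
noncomputable def omegaWeight (n j ℓ : ℕ) (x : ℝ) : ℝ :=
  if ℓ - j ≤ n then (n.choose (ℓ - j) : ℝ) * x ^ (n - (ℓ - j)) * (1 - x) ^ (ℓ - j + 1) else 0

/-- The eigenvalue `∑_{j=0}^ℓ σ_{j,ℓ}(ζ_a) ω_{n,j,ℓ}(ζ_a)` of `ρ_a^{(ℓ)}` at `|n⟩`. -/
noncomputable def rhoEigenvalue (a : ℝ) (ℓ n : ℕ) : ℝ :=
  ∑ j ∈ Finset.range (ℓ + 1), sigmaWeight j ℓ (zetaOf a) * omegaWeight n j ℓ (zetaOf a)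

/-- `g_a(ℓ) = a^ℓ` if `a ≥ 1`, and `(1/a)^{ℓ+1}` if `a < 1`. -/
noncomputable def traceNormBound (a : ℝ) (ℓ : ℕ) : ℝ :=
  if 1 ≤ a then a ^ ℓ else (1 / a) ^ (ℓ + 1)

/-- The characteristic function `⟨W_z⟩_ρ = Tr (W_z ρ)`. -/
noncomputable def weylExpectation (ρ : L2R →L[ℂ] L2R) (z : ℂ) : ℂ :=
  opTrace (weyl z ∘L ρ)

/-! Existence. An operator diagonal in the Hermite basis with summable eigenvalues `c n` satisfies
`Tr (W_z ρ) = ∑ c n ⟨n|W_z|n⟩`. The commutation relations of `W_z` with the ladder operators give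
`⟨n|W_z|n⟩ = L_n(t) exp (-t/2)`, where `t = |z|²/2` (`weylMatrix_diag`). The claim becomes the
scalar identity `∑ λ_n L_n(t) = exp (-t(a-1)/2) L_ℓ(a t)` (`hasSum_rhoEigenvalue_mul_laguerreL`). To
prove it, put `x + y` into the Laguerre generating function and compare powers of `y`: this
evaluates `∑ (n choose m) x^(n-m) L_n(t)` in terms of `L_m(t/(1-x))`. At `x = ζ_a` the weights `σ`
combine these values by the multiplication theorem `laguerreL_mul`, and `(1 + ζ_a)/(1 - ζ_a) = a`.
The trace norm is `∑ |λ_n|`; the triangle inequality over `j` leaves explicit sums.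

Uniqueness. The difference `D` of two solutions can be written `∑ |y_k⟩⟨x_k|` with square summable
norms, and `Tr (W_z D) = ∑ ⟨x_k, W_z y_k⟩ = 0` for all `z`. The average of `W_z` against `exp
(-|z|²/4)` is a nonzero multiple of `|0⟩⟨0|`, hence `⟨0|D|0⟩ = 0`. A product of Weyl operators is a
phase times a Weyl operator, so the same holds for `W_v D W_w`. For real `w` the vectors `W_w|0⟩`
are modulated Gaussians, whose span is dense by Fourier injectivity; therefore `D = 0`
(`IsNuclearRep.eq_zero_of_weyl`). -/

/-! ## Trace class operators as sums of rank one operators -/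

section Nuclear

variable {H : Type*} [NormedAddCommGroup H] [InnerProductSpace ℂ H]

/-- `T = ∑ |yₖ⟩⟨xₖ|` with square summable norms. -/
structure IsNuclearRep {κ : Type*} (T : H →L[ℂ] H) (x y : κ → H) : Prop where
  summable_left : Summable fun k => ‖x k‖ ^ 2
  summable_right : Summable fun k => ‖y k‖ ^ 2
  hasSum : ∀ h, HasSum (fun k => (inner ℂ (x k) h : ℂ) • y k) (T h)

theorem summable_sum_elim {κ κ' : Type*} {f : κ ⊕ κ' → ℝ} (h : Summable fun k => f (Sum.inl k))
    (h' : Summable fun k => f (Sum.inr k)) : Summable f :=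
  (HasSum.sum (f := f) h.hasSum h'.hasSum).summable

theorem IsNuclearRep.sub {κ κ' : Type*} {T T' : H →L[ℂ] H} {x y : κ → H} {x' y' : κ' → H}
    (h : IsNuclearRep T x y) (h' : IsNuclearRep T' x' y') :
    IsNuclearRep (T - T') (Sum.elim x x') (Sum.elim y fun k => -y' k) := by
  refine ⟨summable_sum_elim h.summable_left h'.summable_left,
    summable_sum_elim h.summable_right ?_, fun v => ?_⟩
  · simpa only [Sum.elim_inr, norm_neg] using h'.summable_right
  · rw [sub_apply, sub_eq_add_neg]
    refine HasSum.sum (f := fun k => (inner ℂ (Sum.elim x x' k) v : ℂ) •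
      (Sum.elim y fun k => -y' k) k) (h.hasSum v) ?_
    simpa only [Function.comp_def, Sum.elim_inr, smul_neg] using (h'.hasSum v).neg

theorem summable_mul_of_sq {κ : Type*} {u v : κ → ℝ} (hu : Summable fun k => u k ^ 2)
    (hv : Summable fun k => v k ^ 2) (hu0 : ∀ k, 0 ≤ u k) (hv0 : ∀ k, 0 ≤ v k) :
    Summable fun k => u k * v k := by
  refine Summable.of_nonneg_of_le (fun k => mul_nonneg (hu0 k) (hv0 k)) (fun k => ?_) (hu.add hv)
  nlinarith [sq_nonneg (u k - v k), sq_nonneg (u k), sq_nonneg (v k)]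

theorem hasSum_sq_norm_inner {ι : Type*} (b : HilbertBasis ι ℂ H) (v : H) :
    HasSum (fun i => ‖(inner ℂ (b i) v : ℂ)‖ ^ 2) (‖v‖ ^ 2) := by
  have h := (b.hasSum_inner_mul_inner v v).mapL Complex.reCLM
  have e : ∀ i, Complex.reCLM (inner ℂ v (b i) * inner ℂ (b i) v) =
      ‖(inner ℂ (b i) v : ℂ)‖ ^ 2 := fun i => by
    rw [← inner_conj_symm v (b i), mul_comm, Complex.mul_conj, Complex.reCLM_apply,
      Complex.ofReal_re, Complex.normSq_eq_norm_sq]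
  simp only [e] at h
  convert h using 1
  rw [inner_self_eq_norm_sq_to_K]
  norm_cast

/-- The trace of `W T` for `T = ∑ |yₖ⟩⟨xₖ|`. -/
theorem IsNuclearRep.hasSum_trace {ι κ : Type*} (b : HilbertBasis ι ℂ H) {T : H →L[ℂ] H}
    {x y : κ → H} (h : IsNuclearRep T x y) (W : H →L[ℂ] H) :
    HasSum (fun i => (inner ℂ (b i) (W (T (b i))) : ℂ)) (∑' k, inner ℂ (x k) (W (y k))) := by
  have hy : Summable fun k => ‖W (y k)‖ ^ 2 := by
    refine Summable.of_nonneg_of_le (fun k => by positivity) (fun k => ?_)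
      (h.summable_right.mul_left (‖W‖ ^ 2))
    rw [← mul_pow]
    exact pow_le_pow_left₀ (norm_nonneg _) (W.le_opNorm _) 2
  obtain ⟨f, hfd⟩ : ∃ f : κ × ι → ℂ,
      ∀ k i, f (k, i) = inner ℂ (x k) (b i) * inner ℂ (b i) (W (y k)) :=
    ⟨fun p => inner ℂ (x p.1) (b p.2) *
      inner ℂ (b p.2) (W (y p.1)), fun k i => rfl⟩
  have hf1 : ∀ k, HasSum (fun i => f (k, i)) (inner ℂ (x k) (W (y k))) := fun k => by
    simpa only [hfd] using b.hasSum_inner_mul_inner (x k) (W (y k))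
  -- Absolute summability over both indices: `|uv| ≤ |u|² + |v|²`, then Parseval in `i`. It allows
  -- the sum over `k` to be taken first, which produces the trace in the basis `b`.
  have hf : Summable f := by
    refine Summable.of_norm ((summable_prod_of_nonneg fun p => norm_nonneg _).2
      ⟨fun k => (hf1 k).summable.norm, ?_⟩)
    refine Summable.of_nonneg_of_le (fun k => tsum_nonneg fun i => norm_nonneg _) (fun k => ?_)
      (h.summable_left.add hy)
    rw [← (hasSum_sq_norm_inner b (x k)).tsum_eq, ← (hasSum_sq_norm_inner b (W (y k))).tsum_eq,
      ← (hasSum_sq_norm_inner b (x k)).summable.tsum_add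
        (hasSum_sq_norm_inner b (W (y k))).summable]
    refine Summable.tsum_le_tsum (fun i => ?_) (hf1 k).summable.norm
      ((hasSum_sq_norm_inner b (x k)).summable.add
        (hasSum_sq_norm_inner b (W (y k))).summable)
    rw [hfd, norm_mul, norm_inner_symm]
    nlinarith [sq_nonneg (‖(inner ℂ (b i) (x k) : ℂ)‖ - ‖(inner ℂ (b i) (W (y k)) : ℂ)‖),
      sq_nonneg ‖(inner ℂ (b i) (x k) : ℂ)‖, sq_nonneg ‖(inner ℂ (b i) (W (y k)) : ℂ)‖]
  have hsum : ∑' p, f p = ∑' k, inner ℂ (x k) (W (y k)) := by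
    rw [hf.tsum_prod]
    exact tsum_congr fun k => (hf1 k).tsum_eq
  rw [← hsum]
  refine ((Equiv.prodComm ι κ).hasSum_iff.2 hf.hasSum).prod_fiberwise fun i => ?_
  have := ((h.hasSum (b i)).mapL W).mapL (innerSL ℂ (b i))
  simpa [hfd] using this

theorem ext_hilbertBasis {κ : Type*} (b : HilbertBasis κ ℂ H) {S T : H →L[ℂ] H}
    (h : ∀ k, S (b k) = T (b k)) : S = T := by
  refine ContinuousLinearMap.ext_on (s := Set.range b) ?_ ?_
  · exact Submodule.dense_iff_topologicalClosure_eq_top.2 b.dense_span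
  · rintro _ ⟨k, rfl⟩; exact h k

variable [CompleteSpace H]

/-- Both sides equal the double sum of `|⟨c_k, A b_i⟩|²` by Parseval. This transfers finiteness of
the Hilbert–Schmidt norm from the unspecified basis `onb H` to a basis of choice. -/
theorem tsum_sq_norm_apply_eq {ι κ : Type*} (b : HilbertBasis ι ℂ H) (c : HilbertBasis κ ℂ H)
    {A : H →L[ℂ] H} (hA : IsSelfAdjoint A) :
    ∑' i, ENNReal.ofReal (‖A (b i)‖ ^ 2) = ∑' k, ENNReal.ofReal (‖A (c k)‖ ^ 2) := by
  have hs : ∀ i k, ‖(inner ℂ (c k) (A (b i)) : ℂ)‖ = ‖(inner ℂ (b i) (A (c k)) : ℂ)‖ := by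
    intro i k
    rw [norm_inner_symm, ← ContinuousLinearMap.adjoint_inner_right, hA.adjoint_eq]
  calc _ = ∑' i, ∑' k, ENNReal.ofReal (‖(inner ℂ (c k) (A (b i)) : ℂ)‖ ^ 2) := by
        exact tsum_congr fun i => by
          rw [← (hasSum_sq_norm_inner c (A (b i))).tsum_eq, ENNReal.ofReal_tsum_of_nonneg
            (fun _ => by positivity) (hasSum_sq_norm_inner c (A (b i))).summable]
    _ = ∑' k, ∑' i, ENNReal.ofReal (‖(inner ℂ (b i) (A (c k)) : ℂ)‖ ^ 2) := by
        rw [ENNReal.tsum_comm]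
        simp only [hs]
    _ = _ := by
        exact tsum_congr fun k => by
          rw [← (hasSum_sq_norm_inner b (A (c k))).tsum_eq, ENNReal.ofReal_tsum_of_nonneg
            (fun _ => by positivity) (hasSum_sq_norm_inner b (A (c k))).summable]

theorem isNuclearRep_mul_self {κ : Type*} (c : HilbertBasis κ ℂ H) {A : H →L[ℂ] H}
    (hA : IsSelfAdjoint A) (h : ∑' i, ENNReal.ofReal (‖A (onb H i)‖ ^ 2) ≠ ∞) :
    IsNuclearRep (A * A) (fun k => A (c k)) (fun k => A (c k)) := by
  rw [tsum_sq_norm_apply_eq (onb H) c hA] at h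
  have hs : Summable fun k => ‖A (c k)‖ ^ 2 := by
    have := ENNReal.summable_toReal h
    simpa [ENNReal.toReal_ofReal] using this
  refine ⟨hs, hs, fun v => ?_⟩
  have := (c.hasSum_repr (A v)).mapL A
  simp only [map_smul, HilbertBasis.repr_apply_apply] at this
  simpa [← ContinuousLinearMap.adjoint_inner_left, hA.adjoint_eq] using this

/-- Since `|T| = T⁺ + T⁻`, finite trace norm makes the square roots of `T⁺` and `T⁻`
Hilbert–Schmidt. Each square `A A` expands as `∑ |A c_k⟩⟨A c_k|`, and `T = T⁺ - T⁻`. The basis `c`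
is left free so that a countable index set can be chosen later. -/
theorem exists_isNuclearRep {κ : Type*} (c : HilbertBasis κ ℂ H) {T : H →L[ℂ] H}
    (hT : IsSelfAdjoint T) (h : IsTraceClass T) : ∃ x y : κ ⊕ κ → H, IsNuclearRep T x y := by
  have sqrt_sa : ∀ S : H →L[ℂ] H, IsSelfAdjoint (CFC.sqrt S) := fun S =>
    (CFC.sqrt_nonneg S).isSelfAdjoint
  have hsq : ∀ S : H →L[ℂ] H, 0 ≤ S → ∀ v,
      RCLike.re (inner ℂ v (S v) : ℂ) = ‖CFC.sqrt S v‖ ^ 2 := by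
    intro S hS v
    conv_lhs => rw [← CFC.sqrt_mul_sqrt_self S hS, mul_apply_eq_comp]
    rw [← ContinuousLinearMap.adjoint_inner_left, (sqrt_sa S).adjoint_eq,
      inner_self_eq_norm_sq]
  have habs : ∀ v, RCLike.re (inner ℂ v (CFC.abs T v) : ℂ) =
      ‖CFC.sqrt T⁺ v‖ ^ 2 + ‖CFC.sqrt T⁻ v‖ ^ 2 := by
    intro v
    rw [← CFC.posPart_add_negPart T hT, add_apply, inner_add_right, map_add,
      hsq _ (CFC.posPart_nonneg T), hsq _ (CFC.negPart_nonneg T)]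
  rw [IsTraceClass, traceNorm] at h
  simp only [habs, ENNReal.ofReal_add (sq_nonneg _) (sq_nonneg _)] at h
  rw [ENNReal.tsum_add, ENNReal.add_lt_top] at h
  have := (isNuclearRep_mul_self c (sqrt_sa T⁺) h.1.ne).sub
    (isNuclearRep_mul_self c (sqrt_sa T⁻) h.2.ne)
  rw [CFC.sqrt_mul_sqrt_self _ (CFC.posPart_nonneg T),
    CFC.sqrt_mul_sqrt_self _ (CFC.negPart_nonneg T), CFC.posPart_sub_negPart T hT] at this
  exact ⟨_, _, this⟩

/-! ## Diagonal operators -/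

/-- The operator `∑ cₖ |bₖ⟩⟨bₖ|`. -/
noncomputable def diagOp {κ : Type*} (b : HilbertBasis κ ℂ H) (c : κ → ℝ) : H →L[ℂ] H :=
  ∑' k, (c k : ℂ) • InnerProductSpace.rankOne ℂ (b k) (b k)

variable {κ : Type*} (b : HilbertBasis κ ℂ H) {c : κ → ℝ}

theorem hasSum_diagOp (hc : Summable c) (v : H) :
    HasSum (fun k => ((c k : ℂ) * inner ℂ (b k) v) • b k) (diagOp b c v) := by
  have hs : Summable fun k => (c k : ℂ) • InnerProductSpace.rankOne ℂ (b k) (b k) := by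
    refine Summable.of_norm ?_
    simpa [norm_smul, b.orthonormal.1] using hc.abs
  have := hs.hasSum.mapL (ContinuousLinearMap.apply ℂ H v)
  simpa [diagOp, mul_smul] using this

theorem diagOp_apply_basis (hc : Summable c) (k : κ) : diagOp b c (b k) = (c k : ℂ) • b k := by
  classical
  refine (hasSum_diagOp b hc (b k)).unique ?_
  convert hasSum_single k fun j hj => ?_ using 1
  · simp [b.orthonormal.1]
  · rw [b.orthonormal.2 hj, mul_zero, zero_smul]

theorem hasSum_inner_diagOp (hc : Summable c) (v w : H) :
    HasSum (fun k => (c k : ℂ) * (inner ℂ w (b k) * inner ℂ (b k) v))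
      (inner ℂ w (diagOp b c v)) := by
  have := (hasSum_diagOp b hc v).mapL (innerSL ℂ w)
  simp only [map_smul, innerSL_apply_apply, smul_eq_mul] at this
  have e : (fun k => (c k : ℂ) * (inner ℂ w (b k) * inner ℂ (b k) v)) =
      fun k => (c k : ℂ) * inner ℂ (b k) v * inner ℂ w (b k) := by
    funext k
    ring
  rw [e]
  exact this

theorem isSelfAdjoint_diagOp (hc : Summable c) : IsSelfAdjoint (diagOp b c) := by
  rw [ContinuousLinearMap.isSelfAdjoint_iff_isSymmetric]
  intro v w
  change inner ℂ (diagOp b c v) w = inner ℂ v (diagOp b c w)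
  refine HasSum.unique ?_ (hasSum_inner_diagOp b hc w v)
  have := (hasSum_inner_diagOp b hc v w).mapL (Complex.conjCLE : ℂ →L[ℝ] ℂ)
  simp only [ContinuousLinearEquiv.coe_coe, Complex.conjCLE_apply, map_mul, Complex.conj_ofReal,
    inner_conj_symm] at this
  convert this using 1
  funext k
  ring

theorem diagOp_nonneg (hc : Summable c) (h0 : ∀ k, 0 ≤ c k) : 0 ≤ diagOp b c := by
  rw [ContinuousLinearMap.nonneg_iff_isPositive, ContinuousLinearMap.isPositive_def]
  refine ⟨(isSelfAdjoint_diagOp b hc).isSymmetric, fun v => ?_⟩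
  rw [ContinuousLinearMap.reApplyInnerSelf_apply, inner_re_symm]
  have := (hasSum_inner_diagOp b hc v v).mapL Complex.reCLM
  refine this.nonneg fun k => ?_
  rw [← inner_conj_symm v (b k), mul_comm (conj _), Complex.mul_conj, ← Complex.ofReal_mul]
  exact mul_nonneg (h0 k) (Complex.normSq_nonneg _)

theorem abs_diagOp (hc : Summable c) : CFC.abs (diagOp b c) = diagOp b fun k => |c k| := by
  have hsq : diagOp b (fun k => |c k|) * diagOp b (fun k => |c k|) =
      star (diagOp b c) * diagOp b c := by
    refine ext_hilbertBasis b fun k => ?_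
    rw [(isSelfAdjoint_diagOp b hc).star_eq]
    simp only [mul_apply_eq_comp, diagOp_apply_basis b hc,
      diagOp_apply_basis b hc.abs, map_smul, smul_smul, ← Complex.ofReal_mul, abs_mul_abs_self]
  exact CFC.sqrt_unique hsq (diagOp_nonneg b hc.abs fun k => abs_nonneg _)

/-- The eigenvalue is split into two factors of modulus `√|c k|`, so that summability of `c` is
square summability of each. At `c k = 0` the quotient is `0` by convention, as it should be. -/
theorem isNuclearRep_diagOp (hc : Summable c) :
    IsNuclearRep (diagOp b c) (fun k => (Real.sqrt |c k| : ℂ) • b k)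
      (fun k => ((c k / Real.sqrt |c k| : ℝ) : ℂ) • b k) where
  summable_left := by
    simpa [norm_smul, b.orthonormal.1, Real.sq_sqrt] using hc.abs
  summable_right := by
    refine hc.abs.congr fun k => ?_
    rw [norm_smul, b.orthonormal.1, mul_one, Complex.norm_real, Real.norm_eq_abs, sq_abs, div_pow,
      Real.sq_sqrt (abs_nonneg _), ← sq_abs, sq, mul_self_div_self]
  hasSum v := by
    convert hasSum_diagOp b hc v using 2 with k
    rw [inner_smul_left, smul_smul, Complex.conj_ofReal]
    congr 1
    rcases eq_or_ne (c k) 0 with h | h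
    · simp [h]
    · have : (Real.sqrt |c k| : ℂ) ≠ 0 := by
        simpa [Real.sqrt_eq_zero'] using h
      push_cast
      field_simp

theorem traceNorm_diagOp (hc : Summable c) :
    traceNorm (diagOp b c) = ENNReal.ofReal (∑' k, |c k|) := by
  have h := ((isNuclearRep_diagOp b hc.abs).hasSum_trace (onb H) 1).mapL Complex.reCLM
  have e : ∀ k, (inner ℂ ((Real.sqrt |(|c k|)| : ℂ) • b k)
      (((|c k| / Real.sqrt |(|c k|)| : ℝ) : ℂ) • b k) : ℂ) = (|c k| : ℝ) := by
    intro k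
    rw [inner_smul_left, inner_smul_right, inner_self_eq_norm_sq_to_K, b.orthonormal.1, abs_abs,
      Complex.conj_ofReal]
    rcases eq_or_ne (c k) 0 with h | h
    · simp [h]
    · have : (Real.sqrt |c k| : ℂ) ≠ 0 := by
        simpa [Real.sqrt_eq_zero'] using h
      push_cast
      field_simp
  simp only [one_apply_eq_self, e, ← Complex.ofReal_tsum, Complex.reCLM_apply,
    Complex.ofReal_re] at h
  rw [traceNorm, abs_diagOp b hc, ← h.tsum_eq]
  refine (ENNReal.ofReal_tsum_of_nonneg (fun i => ?_) h.summable).symm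
  have hp := diagOp_nonneg b hc.abs fun k => abs_nonneg _
  rw [ContinuousLinearMap.nonneg_iff_isPositive] at hp
  exact (RCLike.nonneg_iff.1 (hp.inner_nonneg_right _)).1

end Nuclear

/-! ## Creation and annihilation operators in `L²` -/

theorem inner_toLp (f g : 𝓢(ℝ, ℂ)) :
    (inner ℂ (f.toLp 2 volume) (g.toLp 2 volume) : ℂ) = ∫ x, conj (f x) * g x := by
  rw [L2.inner_def]
  refine integral_congr_ae ?_
  filter_upwards [f.coeFn_toLp 2 volume, g.coeFn_toLp 2 volume] with x h1 h2
  rw [h1, h2, RCLike.inner_apply, mul_comm]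

theorem toLp_add (f g : 𝓢(ℝ, ℂ)) :
    (f + g).toLp 2 volume = f.toLp 2 volume + g.toLp 2 volume :=
  map_add (SchwartzMap.toLpCLM ℂ ℂ 2 volume) f g

theorem toLp_sub (f g : 𝓢(ℝ, ℂ)) :
    (f - g).toLp 2 volume = f.toLp 2 volume - g.toLp 2 volume :=
  map_sub (SchwartzMap.toLpCLM ℂ ℂ 2 volume) f g

theorem toLp_smul (c : ℂ) (f : 𝓢(ℝ, ℂ)) : (c • f).toLp 2 volume = c • f.toLp 2 volume :=
  map_smul (SchwartzMap.toLpCLM ℂ ℂ 2 volume) c f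

theorem inner_position (f g : 𝓢(ℝ, ℂ)) :
    (inner ℂ ((positionOp f).toLp 2 volume) (g.toLp 2 volume) : ℂ) =
      inner ℂ (f.toLp 2 volume) ((positionOp g).toLp 2 volume) := by
  rw [inner_toLp, inner_toLp]
  congr 1 with x
  rw [positionOp_apply, positionOp_apply, map_mul, Complex.conj_ofReal]
  ring

theorem inner_deriv (f g : 𝓢(ℝ, ℂ)) :
    (inner ℂ ((SchwartzMap.derivCLM ℂ ℂ f).toLp 2 volume) (g.toLp 2 volume) : ℂ) =
      -inner ℂ (f.toLp 2 volume) ((SchwartzMap.derivCLM ℂ ℂ g).toLp 2 volume) := by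
  rw [inner_toLp, inner_toLp]
  have := SchwartzMap.integral_bilinear_deriv_right_eq_neg_left f g
    ((ContinuousLinearMap.mul ℝ ℂ).comp (Complex.conjCLE : ℂ →L[ℝ] ℂ))
  simp only [ContinuousLinearMap.comp_apply, ContinuousLinearEquiv.coe_coe,
    Complex.conjCLE_apply, ContinuousLinearMap.mul_apply'] at this
  simp only [SchwartzMap.derivCLM_apply]
  rw [this, neg_neg]

theorem annihilationOp_eq : annihilationOp =
    (1 / (Real.sqrt 2 : ℂ)) • (positionOp + SchwartzMap.derivCLM ℂ ℂ) := by
  rw [annihilationOp, momentumOp, smul_smul]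
  simp

theorem creationOp_eq : creationOp =
    (1 / (Real.sqrt 2 : ℂ)) • (positionOp - SchwartzMap.derivCLM ℂ ℂ) := by
  rw [creationOp, momentumOp, smul_smul]
  simp

theorem inner_annihilationOp (f g : 𝓢(ℝ, ℂ)) :
    (inner ℂ ((annihilationOp f).toLp 2 volume) (g.toLp 2 volume) : ℂ) =
      inner ℂ (f.toLp 2 volume) ((creationOp g).toLp 2 volume) := by
  rw [annihilationOp_eq, creationOp_eq]
  simp only [smul_apply, add_apply, sub_apply, toLp_smul, toLp_add, toLp_sub, inner_smul_left,
    inner_smul_right, inner_add_left, inner_sub_right, inner_position, inner_deriv]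
  rw [map_div₀, Complex.conj_ofReal, map_one]
  ring

theorem inner_creationOp (f g : 𝓢(ℝ, ℂ)) :
    (inner ℂ ((creationOp f).toLp 2 volume) (g.toLp 2 volume) : ℂ) =
      inner ℂ (f.toLp 2 volume) ((annihilationOp g).toLp 2 volume) := by
  rw [← inner_conj_symm, ← inner_annihilationOp, inner_conj_symm]

theorem one_div_sqrt_two_mul_self :
    (1 / (Real.sqrt 2 : ℂ)) * (1 / (Real.sqrt 2 : ℂ)) = 1 / 2 := by
  rw [div_mul_div_comm, ← Complex.ofReal_mul, Real.mul_self_sqrt (by norm_num)]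
  norm_num

theorem derivCLM_positionOp (f : 𝓢(ℝ, ℂ)) :
    SchwartzMap.derivCLM ℂ ℂ (positionOp f) = f + positionOp (SchwartzMap.derivCLM ℂ ℂ f) := by
  ext x
  rw [SchwartzMap.derivCLM_apply, add_apply, positionOp_apply, SchwartzMap.derivCLM_apply]
  have h : HasDerivAt (fun y : ℝ => (y : ℂ) * f y) (1 * f x + x * deriv f x) x :=
    (HasDerivAt.ofReal_comp (hasDerivAt_id x)).mul (f.differentiableAt).hasDerivAt
  rw [← (show ⇑(positionOp f) = fun y : ℝ => (y : ℂ) * f y from funext (positionOp_apply f))] at h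
  rw [h.deriv, one_mul]

/-- The canonical commutation relation. -/
theorem annihilationOp_creationOp (f : 𝓢(ℝ, ℂ)) :
    annihilationOp (creationOp f) = creationOp (annihilationOp f) + f := by
  rw [annihilationOp_eq, creationOp_eq]
  simp only [smul_apply, add_apply, sub_apply, map_smul, map_add, map_sub, smul_smul,
    one_div_sqrt_two_mul_self, derivCLM_positionOp, ← smul_sub, ← smul_add]
  module

theorem hermiteSchwartz_zero_apply (x : ℝ) :
    hermiteSchwartz 0 x = ((Real.pi ^ (-(1 / 4) : ℝ) : ℝ) : ℂ) * (Real.exp (-(x ^ 2 / 2)) : ℝ) :=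
  rfl

theorem annihilationOp_hermite_zero : annihilationOp (hermiteSchwartz 0) = 0 := by
  ext x
  have h : HasDerivAt (hermiteSchwartz 0)
      (((Real.pi ^ (-(1 / 4) : ℝ) : ℝ) : ℂ) * ((Real.exp (-(x ^ 2 / 2)) * (-x) : ℝ) : ℂ)) x := by
    have h1 : HasDerivAt (fun y : ℝ => Real.exp (-(y ^ 2 / 2))) (Real.exp (-(x ^ 2 / 2)) * (-x)) x := by
      have h2 : HasDerivAt (fun y : ℝ => -(y ^ 2 / 2)) (-x) x := by
        refine (((hasDerivAt_pow 2 x).div_const 2).neg).congr_deriv ?_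
        simp
      exact h2.exp
    rw [show ⇑(hermiteSchwartz 0) = _ from funext hermiteSchwartz_zero_apply]
    exact h1.ofReal_comp.const_mul _
  rw [annihilationOp_eq, smul_apply, add_apply, smul_apply, add_apply, positionOp_apply,
    SchwartzMap.derivCLM_apply, h.deriv, hermiteSchwartz_zero_apply]
  change _ = (0 : ℂ)
  push_cast
  ring_nf

theorem sqrt_succ_ne_zero (n : ℕ) : (Real.sqrt (n + 1) : ℂ) ≠ 0 :=
  Complex.ofReal_ne_zero.2 (Real.sqrt_pos.2 (by positivity)).ne'

theorem sqrt_succ_mul_self (n : ℕ) : (Real.sqrt (n + 1) : ℂ) * Real.sqrt (n + 1) = n + 1 := by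
  rw [← Complex.ofReal_mul, Real.mul_self_sqrt (by positivity)]
  push_cast; rfl

theorem creationOp_hermite (n : ℕ) :
    creationOp (hermiteSchwartz n) = (Real.sqrt (n + 1) : ℂ) • hermiteSchwartz (n + 1) := by
  rw [hermiteSchwartz, smul_smul, mul_one_div_cancel (sqrt_succ_ne_zero n), one_smul]

theorem annihilationOp_hermite (n : ℕ) :
    annihilationOp (hermiteSchwartz (n + 1)) = (Real.sqrt (n + 1) : ℂ) • hermiteSchwartz n := by
  -- The eigenvalue relation `a a*|n⟩ = (n+1)|n⟩`, by induction: the commutation relation raises the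
  -- eigenvalue by one at each level, starting from `a|0⟩ = 0`.
  have key : annihilationOp (creationOp (hermiteSchwartz n)) =
      ((n : ℂ) + 1) • hermiteSchwartz n := by
    induction n with
    | zero => simp [annihilationOp_creationOp, annihilationOp_hermite_zero]
    | succ n ih =>
      rw [annihilationOp_creationOp]
      conv_lhs => rw [hermiteSchwartz, map_smul, ih, map_smul, map_smul, creationOp_hermite]
      rw [hermiteSchwartz, creationOp_hermite]
      simp only [smul_smul]
      rw [← add_smul]
      congr 1
      have := sqrt_succ_ne_zero n
      field_simp
      push_cast
      ring
  rw [hermiteSchwartz, map_smul, key, smul_smul]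
  congr 1
  rw [one_div_mul_eq_div, div_eq_iff (sqrt_succ_ne_zero n), sqrt_succ_mul_self]

/-! ## The Weyl operators on Schwartz functions -/

theorem hasTemperateGrowth_cexp (s c : ℝ) :
    (fun x : ℝ => Complex.exp (Complex.I * ((s * x + c : ℝ) : ℂ))).HasTemperateGrowth := by
  have hd : ∀ n : ℕ, iteratedDeriv n
      (fun x : ℝ => Complex.exp (Complex.I * ((s * x + c : ℝ) : ℂ))) =
      fun x : ℝ => (Complex.I * s) ^ n * Complex.exp (Complex.I * ((s * x + c : ℝ) : ℂ)) := by
    intro n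
    induction n with
    | zero => simp
    | succ n ih =>
      rw [iteratedDeriv_succ, ih]
      funext x
      have h1 : HasDerivAt (fun x : ℝ => s * x + c) s x := by
        simpa using ((hasDerivAt_id x).const_mul s).add_const c
      rw [(((h1.ofReal_comp.const_mul Complex.I).cexp).const_mul _).deriv]
      ring
  refine ⟨(contDiff_const.mul (Complex.ofRealCLM.contDiff.comp
    (by fun_prop : ContDiff ℝ _ fun x : ℝ => s * x + c))).cexp, fun n => ⟨0, |s| ^ n, fun x => ?_⟩⟩
  rw [norm_iteratedFDeriv_eq_norm_iteratedDeriv, hd, norm_mul,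
    mul_comm Complex.I ((s * x + c : ℝ) : ℂ),
    Complex.norm_exp_ofReal_mul_I]
  simp

/-- The Weyl operator as a map of Schwartz space. -/
noncomputable def weylSchwartz (z : ℂ) : 𝓢(ℝ, ℂ) →L[ℂ] 𝓢(ℝ, ℂ) :=
  (SchwartzMap.smulLeftCLM ℂ
    (fun x : ℝ => Complex.exp (Complex.I * ((z.re * x + z.re * z.im / 2 : ℝ) : ℂ)))).comp
    (SchwartzMap.compSubConstCLM ℂ (-z.im))

theorem weylSchwartz_apply (z : ℂ) (f : 𝓢(ℝ, ℂ)) (x : ℝ) :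
    weylSchwartz z f x = weylFun z f x := by
  rw [weylSchwartz, ContinuousLinearMap.comp_apply,
    SchwartzMap.smulLeftCLM_apply_apply (hasTemperateGrowth_cexp _ _),
    SchwartzMap.compSubConstCLM_apply, sub_neg_eq_add, weylFun, smul_eq_mul]

theorem toLp_weylSchwartz (z : ℂ) (f : 𝓢(ℝ, ℂ)) :
    (weylSchwartz z f).toLp 2 volume = weyl z (f.toLp 2 volume) := by
  apply Lp.ext
  filter_upwards [(weylSchwartz z f).coeFn_toLp 2 volume, coeFn_weyl z (f.toLp 2 volume),
    weylFun_congr z (f.coeFn_toLp 2 volume)] with x h1 h2 h3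
  rw [h1, h2, h3, weylSchwartz_apply]

theorem deriv_weylSchwartz (z : ℂ) (f : 𝓢(ℝ, ℂ)) (x : ℝ) :
    deriv (weylSchwartz z f) x = Complex.I * z.re * weylFun z f x + weylFun z (deriv f) x := by
  rw [show ⇑(weylSchwartz z f) = _ from funext (weylSchwartz_apply z f)]
  have h1 : HasDerivAt (fun x : ℝ => z.re * x + z.re * z.im / 2) z.re x := by
    simpa using ((hasDerivAt_id x).const_mul z.re).add_const (z.re * z.im / 2)
  have h2 : HasDerivAt (fun x : ℝ => f (x + z.im)) (deriv f (x + z.im)) x :=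
    (f.differentiableAt).hasDerivAt.comp_add_const x z.im
  have h := ((h1.ofReal_comp.const_mul Complex.I).cexp).mul h2
  refine (HasDerivAt.deriv (f := weylFun z f) h).trans ?_
  simp only [weylFun]
  ring

/-- Conjugation by `W_z` shifts `a` by a scalar: differentiating the phase contributes `i Re z`, and
writing `x = (x + Im z) - Im z` contributes `-Im z`; together they are `i z`. -/
theorem annihilationOp_weylSchwartz (z : ℂ) (f : 𝓢(ℝ, ℂ)) :
    annihilationOp (weylSchwartz z f) = weylSchwartz z (annihilationOp f) +
      (Complex.I * z / Real.sqrt 2) • weylSchwartz z f := by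
  ext x
  rw [annihilationOp_eq]
  simp only [smul_apply, add_apply, map_smul, map_add, positionOp_apply,
    SchwartzMap.derivCLM_apply, deriv_weylSchwartz, weylSchwartz_apply, weylFun, smul_eq_mul]
  have hz : Complex.I * z = Complex.I * z.re - z.im := by
    conv_lhs => rw [← Complex.re_add_im z]
    linear_combination (z.im : ℂ) * Complex.I_sq
  rw [hz]
  push_cast
  ring

theorem weylSchwartz_creationOp (z : ℂ) (f : 𝓢(ℝ, ℂ)) :
    weylSchwartz z (creationOp f) = creationOp (weylSchwartz z f) +
      (Complex.I * conj z / Real.sqrt 2) • weylSchwartz z f := by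
  ext x
  rw [creationOp_eq]
  simp only [smul_apply, add_apply, sub_apply, map_smul, map_sub, positionOp_apply,
    SchwartzMap.derivCLM_apply, deriv_weylSchwartz, weylSchwartz_apply, weylFun, smul_eq_mul]
  have hz : Complex.I * conj z = Complex.I * z.re + z.im := by
    have : conj z = z.re - z.im * Complex.I := by apply Complex.ext <;> simp
    rw [this]
    linear_combination -(z.im : ℂ) * Complex.I_sq
  rw [hz]
  push_cast
  ring

/-! ## The matrix elements of the Weyl operators -/

/-- The matrix element `⟨m|W_z|n⟩`. -/
noncomputable def weylMatrix (z : ℂ) (m n : ℕ) : ℂ :=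
  inner ℂ (hermiteVec m) (weyl z (hermiteVec n))

theorem weylMatrix_eq (z : ℂ) (m n : ℕ) : weylMatrix z m n =
    inner ℂ (hermiteVec m) ((weylSchwartz z (hermiteSchwartz n)).toLp 2 volume) := by
  rw [toLp_weylSchwartz]; rfl

theorem toLp_creationOp_hermite (n : ℕ) : (creationOp (hermiteSchwartz n)).toLp 2 volume =
    (Real.sqrt (n + 1) : ℂ) • hermiteVec (n + 1) := by
  rw [creationOp_hermite, toLp_smul]; rfl

theorem toLp_annihilationOp_hermite (n : ℕ) :
    (annihilationOp (hermiteSchwartz (n + 1))).toLp 2 volume =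
      (Real.sqrt (n + 1) : ℂ) • hermiteVec n := by
  rw [annihilationOp_hermite, toLp_smul]; rfl

/-- This and the next two recursions come from moving a ladder operator across the inner product and
through `W_z`, with `a|0⟩ = 0` closing the boundary cases. They determine every matrix element from
`⟨0|W_z|0⟩`. -/
theorem weylMatrix_succ_zero (z : ℂ) (m : ℕ) : (Real.sqrt (m + 1) : ℂ) * weylMatrix z (m + 1) 0 =
    Complex.I * z / Real.sqrt 2 * weylMatrix z m 0 := by
  have h := inner_creationOp (hermiteSchwartz m) (weylSchwartz z (hermiteSchwartz 0))
  rw [toLp_creationOp_hermite, annihilationOp_weylSchwartz, annihilationOp_hermite_zero, map_zero,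
    zero_add, toLp_smul, inner_smul_left, inner_smul_right, Complex.conj_ofReal] at h
  rw [weylMatrix_eq, weylMatrix_eq, h]
  rfl

theorem weylMatrix_zero_succ (z : ℂ) (n : ℕ) : (Real.sqrt (n + 1) : ℂ) * weylMatrix z 0 (n + 1) =
    Complex.I * conj z / Real.sqrt 2 * weylMatrix z 0 n := by
  have h := inner_annihilationOp (hermiteSchwartz 0) (weylSchwartz z (hermiteSchwartz n))
  have e := weylSchwartz_creationOp z (hermiteSchwartz n)
  rw [creationOp_hermite, map_smul, ← sub_eq_iff_eq_add] at e
  rw [annihilationOp_hermite_zero, ← e, toLp_sub, inner_sub_right, toLp_smul, toLp_smul,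
    inner_smul_right, inner_smul_right,
    show (0 : 𝓢(ℝ, ℂ)).toLp 2 volume = 0 from map_zero (SchwartzMap.toLpCLM ℂ ℂ 2 volume),
    inner_zero_left, eq_comm, sub_eq_zero] at h
  rw [weylMatrix_eq, weylMatrix_eq]
  exact h

theorem weylMatrix_succ_succ (z : ℂ) (m n : ℕ) :
    (Real.sqrt (n + 1) : ℂ) * weylMatrix z (m + 1) (n + 1) =
      (Real.sqrt (m + 1) : ℂ) * weylMatrix z m n +
        Complex.I * conj z / Real.sqrt 2 * weylMatrix z (m + 1) n := by
  have h := inner_annihilationOp (hermiteSchwartz (m + 1)) (weylSchwartz z (hermiteSchwartz n))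
  have e := weylSchwartz_creationOp z (hermiteSchwartz n)
  rw [creationOp_hermite, map_smul, ← sub_eq_iff_eq_add] at e
  rw [toLp_annihilationOp_hermite, ← e, toLp_sub, inner_sub_right, toLp_smul, toLp_smul,
    inner_smul_left, inner_smul_right, inner_smul_right, Complex.conj_ofReal,
    eq_comm, sub_eq_iff_eq_add] at h
  rw [weylMatrix_eq, weylMatrix_eq, weylMatrix_eq]
  exact h

theorem weylMatrix_zero_zero (z : ℂ) :
    weylMatrix z 0 0 = Complex.exp (-(1 / 4) * (‖z‖ : ℂ) ^ 2) := by
  rw [weylMatrix_eq, hermiteVec, inner_toLp]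
  -- The two normalizations `π^(-1/4)` cancel the factor `√π` of the Gaussian integral, which is
  -- kept in the shape in which `integral_cexp_quadratic` returns it.
  have hpi : ((Real.pi ^ (-(1 / 4) : ℝ) : ℝ) : ℂ) * ((Real.pi ^ (-(1 / 4) : ℝ) : ℝ) : ℂ) *
      ((Real.pi : ℂ) / -(-1)) ^ (1 / 2 : ℂ) = 1 := by
    rw [neg_neg, div_one, show (1 / 2 : ℂ) = ((1 / 2 : ℝ) : ℂ) by push_cast; rfl,
      ← Complex.ofReal_cpow Real.pi_pos.le, ← Complex.ofReal_mul, ← Complex.ofReal_mul,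
      ← Real.rpow_add Real.pi_pos, ← Real.rpow_add Real.pi_pos]
    norm_num
  have h := integral_cexp_quadratic (b := -1) (by norm_num) (Complex.I * z.re - z.im)
    (Complex.I * (z.re * z.im / 2) - z.im ^ 2 / 2)
  calc _ = ∫ x : ℝ, ((Real.pi ^ (-(1 / 4) : ℝ) : ℝ) : ℂ) * ((Real.pi ^ (-(1 / 4) : ℝ) : ℝ) : ℂ) *
        Complex.exp (-1 * (x : ℂ) ^ 2 + (Complex.I * z.re - z.im) * x +
          (Complex.I * (z.re * z.im / 2) - z.im ^ 2 / 2)) := by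
        congr 1 with x
        rw [weylSchwartz_apply, weylFun, hermiteSchwartz_zero_apply, hermiteSchwartz_zero_apply,
          map_mul, Complex.conj_ofReal, Complex.conj_ofReal, Complex.ofReal_exp, Complex.ofReal_exp,
          show ∀ p e₁ e₂ e₃ : ℂ, p * e₁ * (e₂ * (p * e₃)) = p * p * (e₁ * e₂ * e₃) by intros; ring,
          ← Complex.exp_add, ← Complex.exp_add]
        congr 2
        push_cast
        ring
    _ = _ := by
        rw [integral_const_mul, h, ← mul_assoc, hpi, one_mul]
        congr 1
        rw [← Complex.ofReal_pow ‖z‖, Complex.sq_norm, Complex.normSq_apply]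
        push_cast
        linear_combination (1 / 4 * (z.re : ℂ) ^ 2) * Complex.I_sq

/-- The polynomial `∑ₖ k! (m choose k) (n choose k) α^(m-k) β^(n-k)`. -/
noncomputable def weylPoly (α β : ℂ) (m n : ℕ) : ℂ :=
  ∑ k ∈ Finset.range (n + 1), (m.choose k * n.choose k * k.factorial : ℂ) *
    α ^ (m - k) * β ^ (n - k)

theorem weylPoly_zero_right (α β : ℂ) (m : ℕ) : weylPoly α β m 0 = α ^ m := by
  simp [weylPoly]

theorem weylPoly_zero_left (α β : ℂ) (n : ℕ) : weylPoly α β 0 n = β ^ n := by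
  rw [weylPoly, Finset.sum_range_succ']
  simp

/-- The polynomial counts partial matchings between an `m`-set and an `n`-set, with weight `α` or
`β` for each unmatched point on the left or right. A new point on the right is either matched with
one of `m + 1` partners or unmatched. -/
theorem weylPoly_succ_succ (α β : ℂ) (m n : ℕ) : weylPoly α β (m + 1) (n + 1) =
    (m + 1) * weylPoly α β m n + β * weylPoly α β (m + 1) n := by
  have h1 : β * weylPoly α β (m + 1) n = ∑ k ∈ Finset.range (n + 1),
      ((m + 1).choose (k + 1) * n.choose (k + 1) * (k + 1).factorial : ℂ) *
        α ^ (m - k) * β ^ (n - k) + α ^ (m + 1) * β ^ (n + 1) := by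
    have : β * weylPoly α β (m + 1) n = ∑ k ∈ Finset.range (n + 2),
        ((m + 1).choose k * n.choose k * k.factorial : ℂ) *
          α ^ (m + 1 - k) * β ^ (n + 1 - k) := by
      rw [Finset.sum_range_succ, Nat.choose_succ_self, weylPoly, Finset.mul_sum]
      simp only [Nat.cast_zero, mul_zero, zero_mul, add_zero]
      refine Finset.sum_congr rfl fun k hk => ?_
      rw [Nat.succ_sub (Nat.lt_succ_iff.1 (Finset.mem_range.1 hk)), pow_succ]
      ring
    rw [this, Finset.sum_range_succ']
    simp [Nat.succ_sub_succ]
  rw [h1, weylPoly, Finset.sum_range_succ', weylPoly, Finset.mul_sum, ← add_assoc,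
    ← Finset.sum_add_distrib]
  congr 1
  · refine Finset.sum_congr rfl fun k _ => ?_
    have h2 : ((m : ℂ) + 1) * m.choose k = (m + 1).choose (k + 1) * (k + 1) := by
      exact_mod_cast Nat.add_one_mul_choose_eq m k
    rw [Nat.choose_succ_succ n k, Nat.factorial_succ, Nat.succ_sub_succ, Nat.succ_sub_succ]
    push_cast
    linear_combination -(n.choose k * k.factorial * α ^ (m - k) * β ^ (n - k) : ℂ) * h2
  · simp

theorem sqrt_factorial_succ (n : ℕ) : (Real.sqrt (n + 1).factorial : ℂ) =
    Real.sqrt n.factorial * Real.sqrt (n + 1) := by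
  rw [Nat.factorial_succ, mul_comm, Nat.cast_mul, Real.sqrt_mul (by positivity)]
  push_cast
  rfl

/-- Once the factorials clear the square roots, both sides obey the same recursions with the same
initial value. -/
theorem weylMatrix_formula (z : ℂ) (m n : ℕ) :
    (Real.sqrt m.factorial : ℂ) * Real.sqrt n.factorial * weylMatrix z m n =
      weylPoly (Complex.I * z / Real.sqrt 2) (Complex.I * conj z / Real.sqrt 2) m n *
        Complex.exp (-(1 / 4) * (‖z‖ : ℂ) ^ 2) := by
  induction n generalizing m with
  | zero =>
    induction m with
    | zero => simp [weylPoly, weylMatrix_zero_zero]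
    | succ m ih =>
      rw [weylPoly_zero_right] at ih ⊢
      rw [sqrt_factorial_succ, pow_succ]
      linear_combination (Real.sqrt m.factorial * Real.sqrt (Nat.factorial 0) : ℂ) *
        weylMatrix_succ_zero z m + Complex.I * z / Real.sqrt 2 * ih
  | succ n ih =>
    cases m with
    | zero =>
      have := ih 0
      rw [weylPoly_zero_left] at this ⊢
      rw [sqrt_factorial_succ, pow_succ]
      linear_combination (Real.sqrt (Nat.factorial 0) * Real.sqrt n.factorial : ℂ) *
        weylMatrix_zero_succ z n + Complex.I * conj z / Real.sqrt 2 * this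
    | succ m =>
      have h1 := ih (m + 1)
      have h2 := ih m
      have h3 := weylMatrix_succ_succ z m n
      rw [weylPoly_succ_succ]
      rw [sqrt_factorial_succ m] at h1 ⊢
      rw [sqrt_factorial_succ n]
      linear_combination (Real.sqrt m.factorial * Real.sqrt (m + 1) * Real.sqrt n.factorial : ℂ) *
        h3 + Complex.I * conj z / Real.sqrt 2 * h1 + ((m : ℂ) + 1) * h2 +
        (Real.sqrt m.factorial * Real.sqrt n.factorial * weylMatrix z m n : ℂ) *
          sqrt_succ_mul_self m

theorem sqrt_factorial_ne_zero (n : ℕ) : (Real.sqrt n.factorial : ℂ) ≠ 0 :=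
  Complex.ofReal_ne_zero.2 (Real.sqrt_pos.2 (by positivity)).ne'

/-- The diagonal matrix elements of the Weyl operators. -/
theorem weylMatrix_diag (z : ℂ) (n : ℕ) : weylMatrix z n n =
    ((laguerreL n (‖z‖ ^ 2 / 2) * Real.exp (-(1 / 4) * ‖z‖ ^ 2) : ℝ) : ℂ) := by
  have h := weylMatrix_formula z n n
  have hf : (Real.sqrt n.factorial : ℂ) * Real.sqrt n.factorial = n.factorial := by
    rw [← Complex.ofReal_mul, Real.mul_self_sqrt (by positivity)]
    norm_cast
  have hn : (n.factorial : ℂ) ≠ 0 := by exact_mod_cast n.factorial_ne_zero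
  have hL : weylPoly (Complex.I * z / Real.sqrt 2) (Complex.I * conj z / Real.sqrt 2) n n =
      n.factorial * (laguerreL n (‖z‖ ^ 2 / 2) : ℝ) := by
    -- One sum is indexed by the matching size `k`, the other by the power `n - k` of `αβ =
    -- -|z|²/2`.
    rw [weylPoly, laguerreL, ← Finset.sum_range_reflect]
    push_cast
    rw [Finset.mul_sum]
    refine Finset.sum_congr rfl fun k hk => ?_
    have hk' : k ≤ n := Nat.lt_succ_iff.1 (Finset.mem_range.1 hk)
    have hz : Complex.I * z / Real.sqrt 2 * (Complex.I * conj z / Real.sqrt 2) =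
        -((‖z‖ : ℂ) ^ 2 / 2) := by
      rw [← Complex.mul_conj']
      linear_combination (z * conj z * Complex.I ^ 2) * one_div_sqrt_two_mul_self +
        (z * conj z / 2) * Complex.I_sq
    have hc : (n.choose k : ℂ) * k.factorial * (n - k).factorial = n.factorial := by
      exact_mod_cast Nat.choose_mul_factorial_mul_factorial hk'
    have hkf : (k.factorial : ℂ) ≠ 0 := by exact_mod_cast k.factorial_ne_zero
    rw [Nat.sub_sub_self hk', Nat.choose_symm hk', mul_assoc, ← mul_pow, hz, ← hc,
      neg_eq_neg_one_mul, mul_pow]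
    field_simp
  rw [hf, hL, mul_assoc] at h
  rw [mul_left_cancel₀ hn h]
  push_cast
  rfl

/-- This is the case `z = 0` of the matrix formula: with `α = β = 0` only `k = m = n` survives. -/
theorem orthonormal_hermiteVec : Orthonormal ℂ hermiteVec := by
  rw [orthonormal_iff_ite]
  intro m n
  have h := weylMatrix_formula 0 m n
  rw [weylMatrix, weyl_zero] at h
  simp only [mul_zero, map_zero, zero_div, norm_zero, Complex.ofReal_zero, ne_eq,
    OfNat.ofNat_ne_zero, not_false_eq_true, zero_pow, Complex.exp_zero, mul_one,
    one_apply_eq_self] at h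
  have hp : weylPoly 0 0 m n = if m = n then (n.factorial : ℂ) else 0 := by
    rw [weylPoly, Finset.sum_eq_single n]
    · split_ifs with hmn
      · simp [hmn]
      · rcases lt_or_gt_of_ne hmn with h' | h'
        · simp [Nat.choose_eq_zero_of_lt h']
        · simp [zero_pow (Nat.sub_ne_zero_of_lt h')]
    · intro k hk hkn
      have : k < n := lt_of_le_of_ne (Nat.lt_succ_iff.1 (Finset.mem_range.1 hk)) hkn
      simp [zero_pow (Nat.sub_ne_zero_of_lt this)]
    · simp
  rw [hp] at h
  split_ifs at h ⊢ with hmn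
  · subst hmn
    have hf : (Real.sqrt m.factorial : ℂ) * Real.sqrt m.factorial = m.factorial := by
      rw [← Complex.ofReal_mul, Real.mul_self_sqrt (by positivity)]
      norm_cast
    rw [hf] at h
    exact mul_left_cancel₀ (by exact_mod_cast m.factorial_ne_zero) (h.trans (mul_one _).symm)
  · exact (mul_eq_zero.1 h).resolve_left
      (mul_ne_zero (sqrt_factorial_ne_zero m) (sqrt_factorial_ne_zero n))

/-! ## Completeness of the Hermite functions -/

open scoped FourierTransform in
/-- Injectivity of the Fourier transform on integrable functions. -/
theorem ae_eq_zero_of_integral_cexp_eq_zero {F : ℝ → ℂ} (hF : Integrable F)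
    (h : ∀ s : ℝ, ∫ x, Complex.exp (Complex.I * ((s * x : ℝ) : ℂ)) * F x = 0) : F =ᵐ[volume] 0 := by
  have hF0 : 𝓕 F = 0 := by
    funext w
    rw [Real.fourier_real_eq_integral_exp_smul]
    refine (integral_congr_ae (Eventually.of_forall fun x => ?_)).trans (h (-2 * Real.pi * w))
    simp only [smul_eq_mul]
    congr 2
    push_cast
    ring
  refine ae_eq_zero_of_integral_contDiff_smul_eq_zero hF.locallyIntegrable fun g hg hgc => ?_
  have hg' : ContDiff ℝ ((⊤ : ℕ∞) : WithTop ℕ∞) fun x => (g x : ℂ) := Complex.ofRealCLM.contDiff.comp hg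
  have hgc' : HasCompactSupport fun x => (g x : ℂ) := hgc.comp_left (g := Complex.ofReal) rfl
  let ψ : 𝓢(ℝ, ℂ) := hgc'.toSchwartzMap hg'
  -- The test function is the Fourier transform of `φ`, so its pairing with `F` equals the pairing
  -- of `φ` with `𝓕 F = 0`.
  let φ : 𝓢(ℝ, ℂ) := 𝓕⁻ ψ
  have hφ : 𝓕 (φ : ℝ → ℂ) = fun x => (g x : ℂ) := by
    rw [← SchwartzMap.fourier_coe]
    have : 𝓕 φ = ψ := FourierTransform.fourier_fourierInv_eq ψ
    rw [this]
    rfl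
  have key := VectorFourier.integral_fourierIntegral_smul_eq_flip (μ := (volume : Measure ℝ))
    (ν := (volume : Measure ℝ)) (L := innerₗ ℝ) (e := Real.fourierChar) (f := F) (g := φ)
    Real.continuous_fourierChar (by fun_prop) hF φ.integrable
  rw [flip_innerₗ] at key
  change ∫ ξ, (𝓕 F) ξ • φ ξ = ∫ x, F x • (𝓕 (φ : ℝ → ℂ)) x at key
  rw [hF0, hφ] at key
  simp only [Pi.zero_apply, zero_smul, integral_zero] at key
  rw [key]
  congr 1 with x
  rw [Complex.real_smul, smul_eq_mul, mul_comm]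

theorem inner_eq_integral (f g : L2R) : (inner ℂ f g : ℂ) = ∫ x, conj (f x) * g x := by
  rw [L2.inner_def]
  congr 1 with x
  rw [RCLike.inner_apply, mul_comm]

theorem inner_weyl (f g : L2R) (z : ℂ) :
    (inner ℂ f (weyl z g) : ℂ) = ∫ x, conj (f x) * weylFun z g x := by
  rw [inner_eq_integral]
  refine integral_congr_ae ?_
  filter_upwards [coeFn_weyl z g] with x hx
  rw [hx]

theorem memLp_conj (f : L2R) : MemLp (fun x => conj (f x)) 2 volume :=
  (Lp.memLp f).star

theorem hermiteVec_zero_ae :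
    hermiteVec 0 =ᵐ[volume] fun x : ℝ => ((Real.pi ^ (-(1 / 4) : ℝ) : ℝ) : ℂ) *
      (Real.exp (-(x ^ 2 / 2)) : ℝ) :=
  (hermiteSchwartz 0).coeFn_toLp 2 volume

/-- The modulated Gaussians span a dense subspace. -/
theorem eq_zero_of_inner_weyl_real {f : L2R}
    (h : ∀ s : ℝ, (inner ℂ f (weyl (s : ℂ) (hermiteVec 0)) : ℂ) = 0) : f = 0 := by
  have hF : Integrable fun x => conj (f x) * hermiteVec 0 x :=
    (memLp_conj f).integrable_mul (Lp.memLp (hermiteVec 0))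
  -- For real `s`, `W_s` is multiplication by `exp (i s x)`, so the hypothesis says that the Fourier
  -- transform of `conj f` times the Gaussian vanishes. The Gaussian has no zeros and can then be
  -- divided out.
  have h0 := ae_eq_zero_of_integral_cexp_eq_zero hF fun s => by
    rw [← h s, inner_weyl]
    congr 1 with x
    simp only [weylFun, Complex.ofReal_re, Complex.ofReal_im, mul_zero, zero_div, add_zero]
    ring
  rw [Lp.eq_zero_iff_ae_eq_zero]
  filter_upwards [h0, hermiteVec_zero_ae] with x h1 h2
  rw [Pi.zero_apply, h2] at h1
  have hpi : ((Real.pi ^ (-(1 / 4) : ℝ) : ℝ) : ℂ) ≠ 0 :=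
    Complex.ofReal_ne_zero.2 (Real.rpow_pos_of_pos Real.pi_pos _).ne'
  have he : ((Real.exp (-(x ^ 2 / 2)) : ℝ) : ℂ) ≠ 0 :=
    Complex.ofReal_ne_zero.2 (Real.exp_pos _).ne'
  simpa using (mul_eq_zero.1 h1).resolve_right (mul_ne_zero hpi he)

/-- Equality in Bessel's inequality. -/
theorem Orthonormal.inner_eq_zero_of_hasSum {H : Type*} [NormedAddCommGroup H]
    [InnerProductSpace ℂ H] {v : ℕ → H} (hv : Orthonormal ℂ v) {f u : H}
    (hu : HasSum (fun n => ‖(inner ℂ (v n) u : ℂ)‖ ^ 2) (‖u‖ ^ 2))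
    (hf : ∀ n, (inner ℂ f (v n) : ℂ) = 0) : (inner ℂ f u : ℂ) = 0 := by
  let p : ℕ → H := fun N => ∑ n ∈ Finset.range N, (inner ℂ (v n) u : ℂ) • v n
  have hp : ∀ N, ‖u - p N‖ ^ 2 = ‖u‖ ^ 2 - ∑ n ∈ Finset.range N, ‖(inner ℂ (v n) u : ℂ)‖ ^ 2 := by
    intro N
    have e1 : (inner ℂ u (p N) : ℂ) =
        ((∑ n ∈ Finset.range N, ‖(inner ℂ (v n) u : ℂ)‖ ^ 2 : ℝ) : ℂ) := by
      simp only [p, inner_sum, inner_smul_right]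
      push_cast
      refine Finset.sum_congr rfl fun n _ => ?_
      rw [← inner_conj_symm u (v n), Complex.mul_conj']
    have e2 : (inner ℂ (p N) (p N) : ℂ) =
        ((∑ n ∈ Finset.range N, ‖(inner ℂ (v n) u : ℂ)‖ ^ 2 : ℝ) : ℂ) := by
      simp only [p]
      rw [hv.inner_sum]
      push_cast
      refine Finset.sum_congr rfl fun n _ => ?_
      rw [Complex.conj_mul']
    have e3 : ‖p N‖ ^ 2 = ∑ n ∈ Finset.range N, ‖(inner ℂ (v n) u : ℂ)‖ ^ 2 := by
      rw [@norm_sq_eq_re_inner ℂ, e2]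
      exact Complex.ofReal_re _
    rw [@norm_sub_sq ℂ, e1, e3]
    rw [show ∀ r : ℝ, RCLike.re ((r : ℝ) : ℂ) = r from Complex.ofReal_re]
    ring
  have hlim : Tendsto (fun N => ‖u - p N‖) atTop (𝓝 0) := by
    have h2 := (hu.tendsto_sum_nat.const_sub (‖u‖ ^ 2)).sqrt
    rw [sub_self, Real.sqrt_zero] at h2
    refine h2.congr fun N => ?_
    rw [← hp, Real.sqrt_sq (norm_nonneg _)]
  have hle : ∀ N, ‖(inner ℂ f u : ℂ)‖ ≤ ‖f‖ * ‖u - p N‖ := by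
    intro N
    have : (inner ℂ f u : ℂ) = inner ℂ f (u - p N) := by
      simp [p, hf]
    rw [this]
    exact norm_inner_le_norm _ _
  have := ge_of_tendsto' (hlim.const_mul ‖f‖) hle
  rw [mul_zero] at this
  exact norm_le_zero_iff.1 this

/-- The terms are Poisson probabilities of mean `|z|²/2`. Their total mass `1` equals `‖W_z|0⟩‖²`,
which is equality in Bessel's inequality: `W_z|0⟩` lies in the closed span of the Hermite vectors.
Completeness of these follows from that of the modulated Gaussians. -/
theorem hasSum_sq_weylMatrix_zero (z : ℂ) :
    HasSum (fun n => ‖weylMatrix z n 0‖ ^ 2) 1 := by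
  have h : ∀ n, ‖weylMatrix z n 0‖ ^ 2 =
      Real.exp (-(‖z‖ ^ 2 / 2)) * ((‖z‖ ^ 2 / 2) ^ n / n.factorial) := by
    intro n
    have h1 := congrArg (fun c : ℂ => ‖c‖ ^ 2) (weylMatrix_formula z n 0)
    have hr : (-(1 / 4) * (‖z‖ : ℂ) ^ 2) = ((-(1 / 4) * ‖z‖ ^ 2 : ℝ) : ℂ) := by push_cast; rfl
    rw [weylPoly_zero_right, hr, ← Complex.ofReal_exp] at h1
    simp only [norm_mul, Complex.norm_real, Real.norm_eq_abs, mul_pow, sq_abs, norm_pow, norm_div,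
      Complex.norm_I, one_mul, Nat.factorial_zero, Nat.cast_one, Real.sqrt_one, one_pow,
      mul_one] at h1
    rw [Real.sq_sqrt (by positivity), ← pow_mul, mul_comm n 2, pow_mul, div_pow, sq_abs,
      Real.sq_sqrt (by norm_num), ← Real.exp_nat_mul] at h1
    have hn : (n.factorial : ℝ) ≠ 0 := by positivity
    rw [mul_div_assoc', eq_div_iff hn, mul_comm _ (n.factorial : ℝ), h1, mul_comm]
    congr 2
    push_cast
    ring
  simp only [h]
  have := (NormedSpace.expSeries_div_hasSum_exp (‖z‖ ^ 2 / 2 : ℝ)).mul_left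
    (Real.exp (-(‖z‖ ^ 2 / 2)))
  rwa [← Real.exp_eq_exp_ℝ, ← Real.exp_add, neg_add_cancel, Real.exp_zero] at this

theorem norm_hermiteVec (n : ℕ) : ‖hermiteVec n‖ = 1 := orthonormal_hermiteVec.1 n

theorem span_hermiteVec_orthogonal : (Submodule.span ℂ (Set.range hermiteVec))ᗮ = ⊥ := by
  rw [Submodule.eq_bot_iff]
  intro f hf
  rw [Submodule.mem_orthogonal'] at hf
  refine eq_zero_of_inner_weyl_real fun s => ?_
  refine orthonormal_hermiteVec.inner_eq_zero_of_hasSum ?_ fun n =>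
    hf _ (Submodule.subset_span ⟨n, rfl⟩)
  rw [norm_weyl, norm_hermiteVec, one_pow]
  exact hasSum_sq_weylMatrix_zero s

/-- The Hermite basis of `L²(ℝ)`. -/
noncomputable def hermiteBasis : HilbertBasis ℕ ℂ L2R :=
  HilbertBasis.mkOfOrthogonalEqBot orthonormal_hermiteVec span_hermiteVec_orthogonal

theorem hermiteBasis_apply (n : ℕ) : hermiteBasis n = hermiteVec n := by
  rw [hermiteBasis, HilbertBasis.coe_mkOfOrthogonalEqBot]

/-! ## The Gaussian average of the Weyl operators is a multiple of `|0⟩⟨0|` -/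

theorem norm_inner_weyl_le (f g : L2R) (z : ℂ) : ‖(inner ℂ f (weyl z g) : ℂ)‖ ≤ ‖f‖ * ‖g‖ :=
  (norm_inner_le_norm _ _).trans_eq (by rw [norm_weyl])

/-- The constant `∫ exp (-s² / 4) ds`. -/
noncomputable def gaussConst : ℂ := (Real.pi / -(-(1 / 4) : ℂ)) ^ (1 / 2 : ℂ)

theorem gaussConst_ne_zero : gaussConst ≠ 0 := by
  rw [gaussConst, Ne, Complex.cpow_eq_zero_iff]
  simp [Real.pi_ne_zero]

theorem integrable_gauss : Integrable fun s : ℝ => ((Real.exp (-(1 / 4) * s ^ 2) : ℝ) : ℂ) :=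
  (integrable_exp_neg_mul_sq (b := 1 / 4) (by norm_num)).ofReal

theorem integrable_weyl_kernel (f g : L2R) (t : ℝ) :
    Integrable (fun p : ℝ × ℝ => ((Real.exp (-(1 / 4) * p.1 ^ 2) : ℝ) : ℂ) *
      (conj (f p.2) * weylFun ⟨p.1, t⟩ g p.2)) (volume.prod volume) := by
  have hg : MemLp (fun x : ℝ => g (x + t)) 2 volume :=
    (Lp.memLp g).comp_measurePreserving (measurePreserving_add_right volume t)
  have hu : Integrable fun q => conj (f q) * g (q + t) := (memLp_conj f).integrable_mul hg
  have h := integrable_gauss.mul_prod hu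
  have hc : Continuous fun p : ℝ × ℝ =>
      Complex.exp (((p.1 * p.2 + p.1 * t / 2 : ℝ) : ℂ) * Complex.I) := by fun_prop
  have h2 := h.bdd_mul (c := 1) hc.aestronglyMeasurable
    (Eventually.of_forall fun p => (Complex.norm_exp_ofReal_mul_I _).le)
  refine h2.congr (Eventually.of_forall fun p => ?_)
  simp only [weylFun]
  rw [mul_comm Complex.I]
  ring

theorem integrable_gauss_mul_inner_weyl (f g : L2R) (t : ℝ) :
    Integrable fun s : ℝ => ((Real.exp (-(1 / 4) * s ^ 2) : ℝ) : ℂ) *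
      inner ℂ f (weyl ⟨s, t⟩ g) := by
  refine (integrable_weyl_kernel f g t).integral_prod_left.congr
    (Eventually.of_forall fun s => ?_)
  simp only [inner_weyl]
  rw [integral_const_mul]

/-- A function multiplied by a Gaussian. -/
noncomputable def gaussMul (f : L2R) (x : ℝ) : ℂ := ((Real.exp (-(x ^ 2 / 2)) : ℝ) : ℂ) * f x

theorem hermite_const_ne_zero : ((Real.pi ^ (-(1 / 4) : ℝ) : ℝ) : ℂ) ≠ 0 :=
  Complex.ofReal_ne_zero.2 (Real.rpow_pos_of_pos Real.pi_pos _).ne'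

theorem gaussMul_ae (f : L2R) : gaussMul f =ᵐ[volume] fun x =>
    ((Real.pi ^ (-(1 / 4) : ℝ) : ℝ) : ℂ)⁻¹ * (conj (hermiteVec 0 x) * f x) := by
  filter_upwards [hermiteVec_zero_ae] with x hx
  rw [hx, map_mul, Complex.conj_ofReal, Complex.conj_ofReal, gaussMul, mul_assoc,
    inv_mul_cancel_left₀ hermite_const_ne_zero]

theorem integrable_gaussMul (f : L2R) : Integrable (gaussMul f) :=
  ((((memLp_conj (hermiteVec 0)).integrable_mul (Lp.memLp f)).const_mul _).congr
    (gaussMul_ae f).symm)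

theorem integral_gaussMul (f : L2R) : ∫ x, gaussMul f x =
    ((Real.pi ^ (-(1 / 4) : ℝ) : ℝ) : ℂ)⁻¹ * inner ℂ (hermiteVec 0) f := by
  rw [integral_congr_ae (gaussMul_ae f), integral_const_mul, inner_eq_integral]

/-- Integrating the phase over `s` produces `exp (-(q + t/2)²)`. As `(q + t/2)² + t²/4 = q²/2 + (q +
t)²/2`, the factor `exp (-t²/4)` is exactly what splits the result into a function of `q` times a
function of `q + t`. -/
theorem integral_gauss_mul_inner_weyl (f g : L2R) (t : ℝ) :
    ((Real.exp (-(1 / 4) * t ^ 2) : ℝ) : ℂ) * ∫ s : ℝ, ((Real.exp (-(1 / 4) * s ^ 2) : ℝ) : ℂ) *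
      inner ℂ f (weyl ⟨s, t⟩ g) =
    gaussConst * ∫ q : ℝ, conj (gaussMul f q) * gaussMul g (q + t) := by
  have h1 : ∫ s : ℝ, ((Real.exp (-(1 / 4) * s ^ 2) : ℝ) : ℂ) * inner ℂ f (weyl ⟨s, t⟩ g) =
      ∫ s : ℝ, ∫ q : ℝ, ((Real.exp (-(1 / 4) * s ^ 2) : ℝ) : ℂ) *
        (conj (f q) * weylFun ⟨s, t⟩ g q) := by
    congr 1 with s
    rw [inner_weyl, integral_const_mul]
  rw [h1, integral_integral_swap (integrable_weyl_kernel f g t), ← integral_const_mul,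
    ← integral_const_mul]
  congr 1 with q
  have h2 := integral_cexp_quadratic (b := -(1 / 4)) (by norm_num) (Complex.I * (q + t / 2)) 0
  have h3 : ∀ s : ℝ, ((Real.exp (-(1 / 4) * s ^ 2) : ℝ) : ℂ) *
      (conj (f q) * weylFun ⟨s, t⟩ g q) = conj (f q) * g (q + t) *
        Complex.exp (-(1 / 4) * (s : ℂ) ^ 2 + Complex.I * (q + t / 2) * s + 0) := by
    intro s
    rw [weylFun, Complex.ofReal_exp, show ∀ e₁ u e₂ v : ℂ, e₁ * (u * (e₂ * v)) =
      u * v * (e₁ * e₂) by intros; ring, ← Complex.exp_add]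
    congr 2
    push_cast
    ring
  simp only [h3]
  rw [integral_const_mul, h2, ← gaussConst, gaussMul, gaussMul, map_mul, Complex.conj_ofReal,
    Complex.ofReal_exp, Complex.ofReal_exp, Complex.ofReal_exp]
  have h4 : Complex.exp ((-(1 / 4) * t ^ 2 : ℝ) : ℂ) *
      Complex.exp (0 - (Complex.I * (q + t / 2)) ^ 2 / (4 * -(1 / 4))) =
      Complex.exp ((-(q ^ 2 / 2) : ℝ) : ℂ) * Complex.exp ((-((q + t) ^ 2 / 2) : ℝ) : ℂ) := by
    rw [← Complex.exp_add, ← Complex.exp_add]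
    congr 1
    push_cast
    linear_combination ((q : ℂ) + t / 2) ^ 2 * Complex.I_sq
  linear_combination (conj (f q) * g (q + t) * gaussConst) * h4

/-- After the reflection `q ↦ -q` this is the integrand of a convolution of two integrable
functions. -/
theorem integrable_convolution_conj (f g : L2R) :
    Integrable (fun p : ℝ × ℝ => conj (gaussMul f p.2) * gaussMul g (p.2 + p.1))
      (volume.prod volume) := by
  have hf : Integrable fun q => conj (gaussMul f (-q)) := by
    have := (integrable_gaussMul f).comp_neg
    exact (Complex.conjCLE : ℂ →L[ℝ] ℂ).integrable_comp this
  have h := hf.convolution_integrand (ContinuousLinearMap.mul ℝ ℂ) (integrable_gaussMul g)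
    (μ := volume) (ν := volume)
  have hmp : MeasurePreserving (fun p : ℝ × ℝ => (p.1, -p.2)) (volume.prod volume)
      (volume.prod volume) :=
    (MeasurePreserving.id volume).prod (Measure.measurePreserving_neg volume)
  have := hmp.integrable_comp_of_integrable h
  refine this.congr (Eventually.of_forall fun p => ?_)
  simp [add_comm]

theorem integral_convolution_conj (f g : L2R) :
    ∫ t : ℝ, ∫ q : ℝ, conj (gaussMul f q) * gaussMul g (q + t) =
      (∫ q, conj (gaussMul f q)) * ∫ r, gaussMul g r := by
  rw [integral_integral_swap (f := fun t q : ℝ => conj (gaussMul f q) * gaussMul g (q + t))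
    (integrable_convolution_conj f g), ← integral_mul_const]
  congr 1 with q
  rw [integral_const_mul, integral_add_left_eq_self (gaussMul g)]

theorem integrable_integral_gauss_inner_weyl (f g : L2R) :
    Integrable fun t : ℝ => ((Real.exp (-(1 / 4) * t ^ 2) : ℝ) : ℂ) *
      ∫ s : ℝ, ((Real.exp (-(1 / 4) * s ^ 2) : ℝ) : ℂ) * inner ℂ f (weyl ⟨s, t⟩ g) := by
  simp only [integral_gauss_mul_inner_weyl]
  exact (integrable_convolution_conj f g).integral_prod_left.const_mul _

theorem integral_integral_gauss_inner_weyl (f g : L2R) :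
    ∫ t : ℝ, ((Real.exp (-(1 / 4) * t ^ 2) : ℝ) : ℂ) *
      ∫ s : ℝ, ((Real.exp (-(1 / 4) * s ^ 2) : ℝ) : ℂ) * inner ℂ f (weyl ⟨s, t⟩ g) =
    gaussConst * (((Real.pi ^ (-(1 / 4) : ℝ) : ℝ) : ℂ)⁻¹) ^ 2 *
      (inner ℂ f (hermiteVec 0) * inner ℂ (hermiteVec 0) g) := by
  simp only [integral_gauss_mul_inner_weyl]
  rw [integral_const_mul, integral_convolution_conj, integral_conj, integral_gaussMul,
    integral_gaussMul, map_mul, inner_conj_symm, map_inv₀, Complex.conj_ofReal]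
  ring

/-! ## Trace class operators are determined by their Weyl expectations -/

/-- The hypothesis is averaged over `z = s + i t` against the Gaussian, first in `s`, then in `t`.
Sum and integrals commute by the bound `‖x k‖ ‖y k‖`; this is where countability of `κ` enters. -/
theorem tsum_inner_vacuum_eq_zero {κ : Type*} [Countable κ] {x y : κ → L2R}
    (hx : Summable fun k => ‖x k‖ ^ 2) (hy : Summable fun k => ‖y k‖ ^ 2)
    (h : ∀ z, ∑' k, (inner ℂ (x k) (weyl z (y k)) : ℂ) = 0) :
    ∑' k, (inner ℂ (x k) (hermiteVec 0) * inner ℂ (hermiteVec 0) (y k) : ℂ) = 0 := by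
  have hxy : Summable fun k => ‖x k‖ * ‖y k‖ :=
    summable_mul_of_sq hx hy (fun _ => norm_nonneg _) fun _ => norm_nonneg _
  let G : ℝ → ℝ := fun s => Real.exp (-(1 / 4) * s ^ 2)
  have hG : Integrable G := integrable_exp_neg_mul_sq (b := 1 / 4) (by norm_num)
  have hG0 : ∀ s, 0 ≤ G s := fun s => (Real.exp_pos _).le
  have hbd : ∀ k t, ∫ s : ℝ, ‖(G s : ℂ) * inner ℂ (x k) (weyl ⟨s, t⟩ (y k))‖ ≤
      (∫ s, G s) * (‖x k‖ * ‖y k‖) := by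
    intro k t
    rw [← integral_mul_const]
    refine integral_mono (integrable_gauss_mul_inner_weyl _ _ t).norm (hG.mul_const _) fun s => ?_
    dsimp only
    rw [norm_mul, Complex.norm_real, Real.norm_eq_abs, abs_of_nonneg (hG0 s)]
    exact mul_le_mul_of_nonneg_left (norm_inner_weyl_le _ _ _) (hG0 s)
  have h1 : ∀ t : ℝ, ∑' k, ∫ s : ℝ, (G s : ℂ) * inner ℂ (x k) (weyl ⟨s, t⟩ (y k)) = 0 := by
    intro t
    have := hasSum_integral_of_summable_integral_norm
      (fun k => integrable_gauss_mul_inner_weyl (x k) (y k) t)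
      (Summable.of_nonneg_of_le (fun k => integral_nonneg fun s => norm_nonneg _)
        (fun k => hbd k t) (hxy.mul_left _))
    rw [this.tsum_eq]
    simp only [tsum_mul_left, h, mul_zero, integral_zero]
  have h2 := hasSum_integral_of_summable_integral_norm
    (fun k => integrable_integral_gauss_inner_weyl (x k) (y k))
    (Summable.of_nonneg_of_le (fun k => integral_nonneg fun s => norm_nonneg _)
      (fun k => (?_ : _ ≤ (∫ t, G t) * ((∫ s, G s) * (‖x k‖ * ‖y k‖))))
      ((hxy.mul_left _).mul_left _))
  · have h3 := h2.tsum_eq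
    simp only [integral_integral_gauss_inner_weyl] at h3
    rw [tsum_mul_left] at h3
    have h4 : ∀ t : ℝ, ∑' k, ((G t : ℂ) * ∫ s : ℝ, (G s : ℂ) *
        inner ℂ (x k) (weyl ⟨s, t⟩ (y k))) = 0 := fun t => by
      rw [tsum_mul_left, h1, mul_zero]
    refine (mul_eq_zero.1 (h3.trans ?_)).resolve_left
      (mul_ne_zero gaussConst_ne_zero (pow_ne_zero 2 (inv_ne_zero hermite_const_ne_zero)))
    simp only [G] at h4
    simp only [h4, integral_zero]
  · rw [← integral_mul_const]
    refine integral_mono (integrable_integral_gauss_inner_weyl _ _).norm (hG.mul_const _)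
      fun t => ?_
    dsimp only
    rw [norm_mul, Complex.norm_real, Real.norm_eq_abs, abs_of_nonneg (hG0 t)]
    exact mul_le_mul_of_nonneg_left
      ((norm_integral_le_integral_norm _).trans (hbd k t)) (hG0 t)

theorem inner_weyl_weyl (z : ℂ) (f g : L2R) :
    (inner ℂ (weyl z f) (weyl z g) : ℂ) = inner ℂ f g :=
  (⟨(weyl z : L2R →ₗ[ℂ] L2R), norm_weyl z⟩ : L2R →ₗᵢ[ℂ] L2R).inner_map_map f g

theorem weyl_real_neg (w : ℝ) (f : L2R) : weyl (w : ℂ) (weyl ((-w : ℝ) : ℂ) f) = f := by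
  have h := weyl_add 1 w (-w)
  rw [add_neg_cancel, Complex.ofReal_zero, zero_mul, weyl_zero, mul_one, mul_one] at h
  exact (DFunLike.congr_fun h f).symm

theorem inner_weyl_real_neg_left (w : ℝ) (f g : L2R) :
    (inner ℂ (weyl ((-w : ℝ) : ℂ) f) g : ℂ) = inner ℂ f (weyl (w : ℂ) g) := by
  rw [← inner_weyl_weyl (w : ℂ), weyl_real_neg]

theorem weyl_real_comp (w v : ℝ) (z : ℂ) (f : L2R) :
    weyl (w : ℂ) (weyl z (weyl (v : ℂ) f)) =
      Complex.exp (Complex.I * (((v - w) * z.im / 2 : ℝ) : ℂ)) • weyl (w + z + v) f := by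
  apply Lp.ext
  filter_upwards [coeFn_weyl (w : ℂ) (weyl z (weyl (v : ℂ) f)),
    weylFun_congr (w : ℂ) (coeFn_weyl z (weyl (v : ℂ) f)),
    weylFun_congr (w : ℂ) (weylFun_congr z (coeFn_weyl (v : ℂ) f)),
    Lp.coeFn_smul (Complex.exp (Complex.I * (((v - w) * z.im / 2 : ℝ) : ℂ)))
      (weyl (w + z + v) f), coeFn_weyl (w + z + v) f] with x h1 h2 h3 h4 h5
  rw [h1, h2, h3, h4, Pi.smul_apply, h5]
  simp only [weylFun, Complex.add_re, Complex.add_im, Complex.ofReal_re, Complex.ofReal_im,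
    smul_eq_mul, ← mul_assoc, ← Complex.exp_add, add_zero, zero_add]
  congr 2
  push_cast
  ring

theorem IsNuclearRep.eq_zero_of_weyl {κ : Type*} [Countable κ] {D : L2R →L[ℂ] L2R}
    {x y : κ → L2R} (hD : IsNuclearRep D x y)
    (h : ∀ z, ∑' k, (inner ℂ (x k) (weyl z (y k)) : ℂ) = 0) : D = 0 := by
  have key : ∀ v w : ℝ, (inner ℂ (weyl ((-v : ℝ) : ℂ) (hermiteVec 0))
      (D (weyl (w : ℂ) (hermiteVec 0))) : ℂ) = 0 := by
    intro v w
    -- These families represent `W_v D W_w`. Its Weyl traces are phases, independent of `k`, times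
    -- those of `D`, so its vacuum element vanishes too.
    have h1 := tsum_inner_vacuum_eq_zero (x := fun k => weyl ((-w : ℝ) : ℂ) (x k))
      (y := fun k => weyl (v : ℂ) (y k)) (by simpa only [norm_weyl] using hD.summable_left)
      (by simpa only [norm_weyl] using hD.summable_right) fun z => by
        simp only [inner_weyl_real_neg_left, weyl_real_comp, inner_smul_right, tsum_mul_left, h,
          mul_zero]
    have h2 := (hD.hasSum (weyl (w : ℂ) (hermiteVec 0))).mapL
      (innerSL ℂ (weyl ((-v : ℝ) : ℂ) (hermiteVec 0)))
    simp only [map_smul, innerSL_apply_apply, smul_eq_mul] at h2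
    rw [← h2.tsum_eq, ← h1]
    simp only [inner_weyl_real_neg_left]
  have hz : ∀ w : ℝ, D (weyl (w : ℂ) (hermiteVec 0)) = 0 := fun w =>
    eq_zero_of_inner_weyl_real fun s => by
      rw [← inner_conj_symm, show (s : ℂ) = ((-(-s) : ℝ) : ℂ) by simp, key, map_zero]
  -- `D` kills every modulated Gaussian, so the range of its adjoint is orthogonal to all of them.
  have hadj : ContinuousLinearMap.adjoint D = 0 := by
    ext1 f
    refine eq_zero_of_inner_weyl_real fun s => ?_
    rw [ContinuousLinearMap.adjoint_inner_left, hz, inner_zero_right]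
  exact (map_eq_zero_iff _ (ContinuousLinearMap.adjoint (𝕜 := ℂ)).injective).1 hadj

theorem eq_of_weylExpectation_eq {ρ ρ' : L2R →L[ℂ] L2R} (hρ : IsSelfAdjoint ρ)
    (hρt : IsTraceClass ρ) (hρ' : IsSelfAdjoint ρ') (hρt' : IsTraceClass ρ')
    (h : ∀ z, weylExpectation ρ z = weylExpectation ρ' z) : ρ = ρ' := by
  obtain ⟨x, y, hxy⟩ := exists_isNuclearRep hermiteBasis hρ hρt
  obtain ⟨x', y', hxy'⟩ := exists_isNuclearRep hermiteBasis hρ' hρt'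
  have hD := hxy.sub hxy'
  refine sub_eq_zero.1 (hD.eq_zero_of_weyl fun z => ?_)
  have h1 := hD.hasSum_trace (onb L2R) (weyl z)
  have h2 := (hxy.hasSum_trace (onb L2R) (weyl z)).sub (hxy'.hasSum_trace (onb L2R) (weyl z))
  simp only [sub_apply, map_sub, inner_sub_right] at h1
  rw [h1.unique h2, ← (hxy.hasSum_trace (onb L2R) (weyl z)).tsum_eq,
    ← (hxy'.hasSum_trace (onb L2R) (weyl z)).tsum_eq]
  exact sub_eq_zero.2 (h z)

/-! ## Laguerre polynomials and their generating functions -/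

theorem HasSum.congr_value {f : ℕ → ℝ} {a b : ℝ} (h : HasSum f a) (e : b = a) : HasSum f b :=
  e ▸ h

theorem laguerreL_eq_sum_of_le {n N : ℕ} (h : n ≤ N) (x : ℝ) :
    laguerreL n x = ∑ k ∈ Finset.range (N + 1), (-x) ^ k / (k.factorial : ℝ) * (n.choose k : ℝ) := by
  rw [laguerreL]
  simp only [← mul_pow, neg_one_mul]
  refine Finset.sum_subset (by simpa using h) fun k _ hk => ?_
  rw [Nat.choose_eq_zero_of_lt (by simpa using hk), Nat.cast_zero, mul_zero]

/-- At `-|x|` all terms are nonnegative, so the majorant is again a Laguerre value, summed by the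
same generating function. -/
theorem abs_laguerreL_le (n : ℕ) (x : ℝ) : |laguerreL n x| ≤ laguerreL n (-|x|) := by
  rw [laguerreL_eq_sum_of_le le_rfl, laguerreL_eq_sum_of_le le_rfl]
  refine (Finset.abs_sum_le_sum_abs _ _).trans_eq (Finset.sum_congr rfl fun k _ => ?_)
  rw [abs_mul, abs_div, abs_pow, abs_neg, Nat.abs_cast, Nat.abs_cast, neg_neg]

theorem hasSum_choose_mul_pow (k : ℕ) {r : ℝ} (hr : |r| < 1) :
    HasSum (fun n : ℕ => (n.choose k : ℝ) * r ^ (n - k)) (1 / (1 - r) ^ (k + 1)) := by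
  have h := hasSum_choose_mul_geometric_of_norm_lt_one k (r := r) hr
  refine ((add_left_injective k).hasSum_iff fun n hn => ?_).1 (h.congr_fun ?_)
  · have : n < k := by
      by_contra hk
      exact hn ⟨n - k, Nat.sub_add_cancel (not_lt.1 hk)⟩
    rw [Nat.choose_eq_zero_of_lt this, Nat.cast_zero, zero_mul]
  · intro n
    simp

/-- Summing over the degree first gives `∑_n (n choose k) r^n = r^k/(1-r)^(k+1)`; what remains is an
exponential series. Replacing `t, r` by `-|t|, |r|` gives the absolute values, hence the
interchange. -/
theorem hasSum_laguerreL_generating (t : ℝ) {r : ℝ} (hr : |r| < 1) :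
    HasSum (fun n : ℕ => r ^ n * laguerreL n t) (Real.exp (-(t * r / (1 - r))) / (1 - r)) := by
  let F : ℝ → ℝ → ℕ × ℕ → ℝ := fun t r p =>
    (-t) ^ p.1 / (p.1.factorial : ℝ) * ((p.2.choose p.1 : ℝ) * r ^ p.2)
  have hin : ∀ t r : ℝ, |r| < 1 → ∀ k, HasSum (fun n => F t r (k, n))
      ((-t) ^ k / (k.factorial : ℝ) * (r ^ k * (1 / (1 - r) ^ (k + 1)))) := by
    intro t r hr k
    refine (((hasSum_choose_mul_pow k hr).mul_left (r ^ k)).congr_fun fun n => ?_).mul_left _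
    rcases lt_or_ge n k with h | h
    · simp [Nat.choose_eq_zero_of_lt h]
    · rw [mul_left_comm, ← pow_add, Nat.add_sub_cancel' h]
  have hout : ∀ t r : ℝ, |r| < 1 → HasSum
      (fun k : ℕ => (-t) ^ k / (k.factorial : ℝ) * (r ^ k * (1 / (1 - r) ^ (k + 1))))
      (Real.exp (-(t * r / (1 - r))) / (1 - r)) := by
    intro t r hr
    have h1 : (1 - r) ≠ 0 := by linarith [(abs_lt.1 hr).2]
    have h := (NormedSpace.expSeries_div_hasSum_exp (-(t * r / (1 - r)) : ℝ)).mul_right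
      (1 - r)⁻¹
    rw [← Real.exp_eq_exp_ℝ, ← div_eq_mul_inv] at h
    refine h.congr_fun fun k => ?_
    rw [show -(t * r / (1 - r)) = -t * r / (1 - r) by ring, div_pow, mul_pow, pow_succ]
    field_simp
  have habs : ∀ p, ‖F t r p‖ = F (-|t|) |r| p := by
    intro p
    simp only [F, Real.norm_eq_abs, abs_mul, abs_div, abs_pow, abs_neg, Nat.abs_cast, neg_neg]
  have hr' : |(|r|)| < 1 := by rwa [abs_abs]
  have hs : Summable (F t r) := by
    refine Summable.of_norm ((summable_prod_of_nonneg fun p => norm_nonneg _).2 ⟨fun k => ?_, ?_⟩)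
    · simp only [habs]
      exact (hin (-|t|) |r| hr' k).summable
    · simp only [habs, (hin (-|t|) |r| hr' _).tsum_eq]
      exact (hout (-|t|) |r| hr').summable
  have hsum : HasSum (F t r) (Real.exp (-(t * r / (1 - r))) / (1 - r)) := by
    have := hs.hasSum.prod_fiberwise (hin t r hr)
    rw [← this.unique (hout t r hr)]
    exact hs.hasSum
  refine ((Equiv.prodComm ℕ ℕ).hasSum_iff.2 hsum).prod_fiberwise fun n => ?_
  rw [laguerreL_eq_sum_of_le le_rfl, Finset.mul_sum]
  have h0 := hasSum_sum_of_ne_finset_zero (L := .unconditional ℕ) (f := fun k => F t r (k, n))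
    (s := Finset.range (n + 1)) fun k hk => by
      simp [F, Nat.choose_eq_zero_of_lt (show n < k by simpa using hk)]
  refine h0.congr_value (Finset.sum_congr rfl fun k _ => ?_)
  simp only [F]
  ring

theorem summable_pow_mul_abs_laguerreL (t : ℝ) {r : ℝ} (h0 : 0 ≤ r) (hr : r < 1) :
    Summable fun n : ℕ => r ^ n * |laguerreL n t| := by
  refine Summable.of_nonneg_of_le (fun n => by positivity) (fun n => ?_)
    (hasSum_laguerreL_generating (-|t|) (r := r) (by rwa [abs_of_nonneg h0])).summable
  exact mul_le_mul_of_nonneg_left (abs_laguerreL_le n t) (by positivity)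

theorem hasSum_add_pow (x y : ℝ) (n : ℕ) :
    HasSum (fun m : ℕ => (n.choose m : ℝ) * x ^ (n - m) * y ^ m) ((x + y) ^ n) := by
  rw [add_comm x y, add_pow]
  have h0 := hasSum_sum_of_ne_finset_zero (L := .unconditional ℕ)
    (f := fun m : ℕ => (n.choose m : ℝ) * x ^ (n - m) * y ^ m)
    (s := Finset.range (n + 1)) fun k hk => by
      simp [Nat.choose_eq_zero_of_lt (show n < k by simpa using hk)]
  refine h0.congr_value (Finset.sum_congr rfl fun k _ => ?_)
  ring

/-- The generating function at `r = x + y`, expanded by the binomial theorem and regrouped by powers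
of `y`; `|x| + |y| < 1` makes the double series absolutely convergent. -/
theorem hasSum_shifted_generating (t : ℝ) {x y : ℝ} (hxy : |x| + |y| < 1) :
    (∀ m : ℕ, Summable fun n : ℕ => (n.choose m : ℝ) * x ^ (n - m) * y ^ m * laguerreL n t) ∧
    HasSum (fun m : ℕ => ∑' n : ℕ, (n.choose m : ℝ) * x ^ (n - m) * y ^ m * laguerreL n t)
      (Real.exp (-(t * (x + y) / (1 - (x + y)))) / (1 - (x + y))) := by
  let F : ℕ × ℕ → ℝ := fun p =>
    (p.1.choose p.2 : ℝ) * x ^ (p.1 - p.2) * y ^ p.2 * laguerreL p.1 t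
  have hin : ∀ n, HasSum (fun m => F (n, m)) ((x + y) ^ n * laguerreL n t) := fun n =>
    (hasSum_add_pow x y n).mul_right _
  have hF : Summable F := by
    have habs : ∀ n, HasSum (fun m => ‖F (n, m)‖) ((|x| + |y|) ^ n * |laguerreL n t|) := by
      intro n
      refine ((hasSum_add_pow (|x|) (|y|) n).mul_right |laguerreL n t|).congr_fun fun m => ?_
      simp only [F, Real.norm_eq_abs, abs_mul, abs_pow, Nat.abs_cast]
    refine Summable.of_norm ((summable_prod_of_nonneg fun p => norm_nonneg _).2
      ⟨fun n => (habs n).summable, ?_⟩)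
    simp only [(habs _).tsum_eq]
    exact summable_pow_mul_abs_laguerreL t (by positivity) hxy
  have hsum := hF.hasSum.prod_fiberwise hin
  have heq := hsum.unique (hasSum_laguerreL_generating t ((abs_add_le x y).trans_lt hxy))
  have hswap : Summable (F ∘ Equiv.prodComm ℕ ℕ) := (Equiv.prodComm ℕ ℕ).summable_iff.2 hF
  have hfib : ∀ m : ℕ, Summable fun n : ℕ => F (n, m) := fun m => hswap.prod_factor m
  refine ⟨hfib, ?_⟩
  rw [← heq]
  exact ((Equiv.prodComm ℕ ℕ).hasSum_iff.2 hF.hasSum).prod_fiberwise fun m => (hfib m).hasSum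

theorem eq_of_hasSum_pow_mul {c d : ℕ → ℝ} {f : ℝ → ℝ} {δ : ℝ} (hδ : 0 < δ)
    (hc : ∀ y, |y| < δ → HasSum (fun n => y ^ n * c n) (f y))
    (hd : ∀ y, |y| < δ → HasSum (fun n => y ^ n * d n) (f y)) : c = d := by
  have key : ∀ c : ℕ → ℝ, (∀ y, |y| < δ → HasSum (fun n => y ^ n * c n) (f y)) →
      HasFPowerSeriesAt f (FormalMultilinearSeries.ofScalars ℝ c) 0 := by
    intro c hc
    rw [hasFPowerSeriesAt_iff]
    filter_upwards [Metric.ball_mem_nhds (0 : ℝ) hδ] with y hy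
    rw [Metric.mem_ball, dist_zero_right, Real.norm_eq_abs] at hy
    simpa only [FormalMultilinearSeries.coeff_ofScalars, smul_eq_mul, zero_add] using hc y hy
  funext n
  have := congrArg (fun p => FormalMultilinearSeries.coeff p n)
    ((key c hc).eq_formalMultilinearSeries (key d hd))
  simpa only [FormalMultilinearSeries.coeff_ofScalars] using this

/-- Both sides are the coefficient of `y^m` in the generating function at `x + y`: the right side
comes from rewriting that function as a generating function in `y/(1-x)` with argument `t/(1-x)`. -/
theorem hasSum_choose_mul_laguerreL (t : ℝ) {x : ℝ} (hx : |x| < 1) (m : ℕ) :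
    HasSum (fun n : ℕ => (n.choose m : ℝ) * x ^ (n - m) * laguerreL n t)
      (Real.exp (-(t * x / (1 - x))) * laguerreL m (t / (1 - x)) / (1 - x) ^ (m + 1)) := by
  have hx1 : 0 < 1 - x := by linarith [(abs_lt.1 hx).2]
  have hδ : 0 < 1 - |x| := by linarith
  have hle : 1 - |x| ≤ 1 - x := by linarith [le_abs_self x]
  have hs : Summable fun n : ℕ => (n.choose m : ℝ) * x ^ (n - m) * laguerreL n t := by
    -- Any nonzero `y` with `|x| + |y| < 1` would do; the factor `y^m` is then cancelled.
    have h := (hasSum_shifted_generating t (x := x) (y := (1 - |x|) / 2)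
      (by rw [abs_of_pos (by linarith : 0 < (1 - |x|) / 2)]; linarith)).1 m
    have hy : ((1 - |x|) / 2) ^ m ≠ 0 := pow_ne_zero _ (by linarith)
    refine (summable_mul_left_iff hy).1 (h.congr fun n => ?_)
    ring
  have key := eq_of_hasSum_pow_mul
    (c := fun m => ∑' n : ℕ, (n.choose m : ℝ) * x ^ (n - m) * laguerreL n t)
    (d := fun m => Real.exp (-(t * x / (1 - x))) * laguerreL m (t / (1 - x)) / (1 - x) ^ (m + 1))
    (f := fun y => Real.exp (-(t * (x + y) / (1 - (x + y)))) / (1 - (x + y))) hδ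
    (fun y hy => by
      refine (hasSum_shifted_generating t (by linarith)).2.congr_fun fun m => ?_
      rw [← tsum_mul_left]
      exact tsum_congr fun n => by ring)
    (fun y hy => by
      have hu : |y / (1 - x)| < 1 := by
        rw [abs_div, abs_of_pos hx1, div_lt_one hx1]
        linarith
      have hy1 : 0 < 1 - (x + y) := by linarith [(abs_lt.1 hy).2]
      have hu1 : 1 - y / (1 - x) = (1 - (x + y)) / (1 - x) := by
        field_simp
        ring
      have h := (hasSum_laguerreL_generating (t / (1 - x)) hu).mul_left
        (Real.exp (-(t * x / (1 - x))) / (1 - x))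
      rw [hu1, div_mul_div_comm, ← Real.exp_add, mul_div_cancel₀ _ hx1.ne'] at h
      have he : -(t * x / (1 - x)) + -(t / (1 - x) * (y / (1 - x)) / ((1 - (x + y)) / (1 - x))) =
          -(t * (x + y) / (1 - (x + y))) := by
        have := hy1.ne'
        have := hx1.ne'
        field_simp
        ring
      rw [he] at h
      refine h.congr_fun fun m => ?_
      rw [div_pow, pow_succ]
      field_simp)
  have := congrFun key m
  rw [← this]
  exact hs.hasSum

/-- The `k`-th factorial moment of a binomial distribution, divided by `k!`: extract `ℓ.choose k`
and sum the rest as `(c + (1 - c))^(ℓ-k) = 1`. -/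
theorem sum_choose_mul_choose (c : ℝ) {ℓ k : ℕ} (hk : k ≤ ℓ) :
    ∑ m ∈ Finset.range (ℓ + 1), (ℓ.choose m : ℝ) * c ^ m * (1 - c) ^ (ℓ - m) * (m.choose k : ℝ) =
      ℓ.choose k * c ^ k := by
  obtain ⟨p, rfl⟩ := Nat.exists_eq_add_of_le hk
  rw [add_assoc, Finset.sum_range_add, Finset.sum_eq_zero, zero_add]
  · have h : ∀ i ∈ Finset.range (p + 1), ((k + p).choose (k + i) : ℝ) * c ^ (k + i) *
        (1 - c) ^ (k + p - (k + i)) * ((k + i).choose k : ℝ) =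
        ((k + p).choose k * c ^ k) * (c ^ i * (1 - c) ^ (p - i) * p.choose i) := by
      intro i hi
      have h1 : (((k + p).choose (k + i) : ℕ) : ℝ) * ((k + i).choose k : ℕ) =
          ((k + p).choose k : ℕ) * (p.choose i : ℕ) := by
        have := Nat.choose_mul (n := k + p) (k := k + i) (s := k) (by omega)
        rw [Nat.add_sub_cancel_left, Nat.add_sub_cancel_left] at this
        exact_mod_cast this
      rw [Nat.add_sub_add_left, pow_add]
      linear_combination c ^ k * c ^ i * (1 - c) ^ (p - i) * h1
    rw [Finset.sum_congr rfl h, ← Finset.mul_sum, ← add_pow, add_sub_cancel, one_pow, mul_one]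
  · intro m hm
    rw [Nat.choose_eq_zero_of_lt (Finset.mem_range.1 hm), Nat.cast_zero, mul_zero]

/-- The multiplication theorem for Laguerre polynomials. -/
theorem laguerreL_mul (c x : ℝ) (ℓ : ℕ) :
    ∑ m ∈ Finset.range (ℓ + 1), (ℓ.choose m : ℝ) * c ^ m * (1 - c) ^ (ℓ - m) * laguerreL m x =
      laguerreL ℓ (c * x) := by
  rw [laguerreL_eq_sum_of_le le_rfl (c * x)]
  have h : ∀ m ∈ Finset.range (ℓ + 1),
      (ℓ.choose m : ℝ) * c ^ m * (1 - c) ^ (ℓ - m) * laguerreL m x =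
        ∑ k ∈ Finset.range (ℓ + 1), (-x) ^ k / (k.factorial : ℝ) *
          ((ℓ.choose m : ℝ) * c ^ m * (1 - c) ^ (ℓ - m) * (m.choose k : ℝ)) := by
    intro m hm
    rw [laguerreL_eq_sum_of_le (Nat.lt_succ_iff.1 (Finset.mem_range.1 hm)), Finset.mul_sum]
    exact Finset.sum_congr rfl fun k _ => by ring
  rw [Finset.sum_congr rfl h, Finset.sum_comm]
  refine Finset.sum_congr rfl fun k hk => ?_
  rw [← Finset.mul_sum, sum_choose_mul_choose c (Nat.lt_succ_iff.1 (Finset.mem_range.1 hk)),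
    neg_mul_eq_mul_neg, mul_pow]
  ring

/-! ## The eigenvalues -/

theorem omegaWeight_eq (n j ℓ : ℕ) (x : ℝ) : omegaWeight n j ℓ x =
    (n.choose (ℓ - j) : ℝ) * x ^ (n - (ℓ - j)) * (1 - x) ^ (ℓ - j + 1) := by
  rw [omegaWeight]
  split_ifs with h
  · rfl
  · rw [Nat.choose_eq_zero_of_lt (not_le.1 h), Nat.cast_zero, zero_mul, zero_mul]

theorem abs_zetaOf_lt_one {a : ℝ} (ha : 0 < a) : |zetaOf a| < 1 := by
  rw [zetaOf, abs_lt, lt_div_iff₀ (by linarith), div_lt_one (by linarith)]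
  constructor <;> linarith

theorem hasSum_abs_omegaWeight (j ℓ : ℕ) {x : ℝ} (hx : |x| < 1) :
    HasSum (fun n => |omegaWeight n j ℓ x|) (((1 - x) / (1 - |x|)) ^ (ℓ - j + 1)) := by
  have hx1 : 0 < 1 - x := by linarith [(abs_lt.1 hx).2]
  have h := (hasSum_choose_mul_pow (ℓ - j) (r := |x|) (by rwa [abs_abs])).mul_right
    ((1 - x) ^ (ℓ - j + 1))
  rw [one_div_mul_eq_div, ← div_pow] at h
  refine h.congr_fun fun n => ?_
  rw [omegaWeight_eq, abs_mul, abs_mul, Nat.abs_cast, abs_pow, abs_pow, abs_of_pos hx1]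

theorem hasSum_omegaWeight_mul_laguerreL (j ℓ : ℕ) (t : ℝ) {x : ℝ} (hx : |x| < 1) :
    HasSum (fun n => omegaWeight n j ℓ x * laguerreL n t)
      (Real.exp (-(t * x / (1 - x))) * laguerreL (ℓ - j) (t / (1 - x))) := by
  have hx1 : 0 < 1 - x := by linarith [(abs_lt.1 hx).2]
  have h := (hasSum_choose_mul_laguerreL t hx (ℓ - j)).mul_right ((1 - x) ^ (ℓ - j + 1))
  rw [div_mul_cancel₀ _ (pow_ne_zero _ hx1.ne')] at h
  refine h.congr_fun fun n => ?_
  rw [omegaWeight_eq]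
  ring

theorem abs_rhoEigenvalue_le (a : ℝ) (ℓ n : ℕ) : |rhoEigenvalue a ℓ n| ≤
    ∑ j ∈ Finset.range (ℓ + 1), |sigmaWeight j ℓ (zetaOf a)| * |omegaWeight n j ℓ (zetaOf a)| := by
  refine (Finset.abs_sum_le_sum_abs _ _).trans_eq (Finset.sum_congr rfl fun j _ => ?_)
  rw [abs_mul]

/-- Summing over `n` gives `R^(ℓ-j+1)` with `R = (1-ζ)/(1-|ζ|)`; the sum over `j` is then a binomial
expansion. -/
theorem hasSum_abs_sigma_mul_omega {a : ℝ} (ha : 0 < a) (ℓ : ℕ) :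
    HasSum (fun n => ∑ j ∈ Finset.range (ℓ + 1),
      |sigmaWeight j ℓ (zetaOf a)| * |omegaWeight n j ℓ (zetaOf a)|)
      ((1 - zetaOf a) / (1 - |zetaOf a|) *
        (|zetaOf a| + (1 + zetaOf a) * ((1 - zetaOf a) / (1 - |zetaOf a|))) ^ ℓ) := by
  have hz := abs_zetaOf_lt_one ha
  have h := hasSum_sum (s := Finset.range (ℓ + 1)) fun j _ =>
    (hasSum_abs_omegaWeight j ℓ hz).mul_left |sigmaWeight j ℓ (zetaOf a)|
  rw [add_pow, Finset.mul_sum]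
  refine h.congr_value (Finset.sum_congr rfl fun j _ => ?_)
  have h1 : 0 < 1 + zetaOf a := by linarith [(abs_lt.1 hz).1]
  rw [sigmaWeight, abs_mul, abs_mul, Nat.abs_cast, abs_pow, abs_pow, abs_neg, abs_of_pos h1,
    mul_pow, pow_succ]
  ring

theorem summable_abs_rhoEigenvalue {a : ℝ} (ha : 0 < a) (ℓ : ℕ) :
    Summable fun n => |rhoEigenvalue a ℓ n| :=
  Summable.of_nonneg_of_le (fun _ => abs_nonneg _) (abs_rhoEigenvalue_le a ℓ)
    (hasSum_abs_sigma_mul_omega ha ℓ).summable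

theorem tsum_abs_rhoEigenvalue_le {a : ℝ} (ha : 0 < a) (ℓ : ℕ) :
    ∑' n, |rhoEigenvalue a ℓ n| ≤ traceNormBound a ℓ := by
  refine ((summable_abs_rhoEigenvalue ha ℓ).tsum_le_tsum (abs_rhoEigenvalue_le a ℓ)
    (hasSum_abs_sigma_mul_omega ha ℓ).summable).trans ?_
  rw [(hasSum_abs_sigma_mul_omega ha ℓ).tsum_eq, traceNormBound]
  have ha1 : (a + 1) ≠ 0 := by linarith
  split_ifs with h
  · have hz : 0 ≤ zetaOf a := div_nonneg (by linarith) (by linarith)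
    have hz1 := abs_zetaOf_lt_one ha
    rw [abs_of_nonneg hz] at hz1 ⊢
    rw [div_self (by linarith), one_mul, mul_one]
    refine pow_le_pow_left₀ (by linarith) ?_ ℓ
    rw [zetaOf, show (a - 1) / (a + 1) + (1 + (a - 1) / (a + 1)) = (3 * a - 1) / (a + 1) by
      field_simp; ring, div_le_iff₀ (by linarith)]
    -- Here `R = 1`, and `3a - 1 ≤ a(a + 1)` is `(a - 1)² ≥ 0`.
    nlinarith [sq_nonneg (a - 1)]
  · have hz : zetaOf a < 0 := div_neg_of_neg_of_pos (by linarith) (by linarith)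
    have hR : (1 - zetaOf a) / (1 - -zetaOf a) = 1 / a := by
      rw [zetaOf]
      have : 1 - -((a - 1) / (a + 1)) = 2 * a / (a + 1) := by field_simp; ring
      rw [this]
      field_simp
      ring
    have hz1 := abs_zetaOf_lt_one ha
    rw [abs_of_neg hz] at hz1 ⊢
    have h1a : 1 ≤ 1 / a := by
      rw [le_div_iff₀ ha]
      linarith
    rw [hR, pow_succ, mul_comm]
    refine mul_le_mul_of_nonneg_right (pow_le_pow_left₀ ?_ ?_ ℓ) (by positivity)
    · have : 0 ≤ (1 + zetaOf a) * (1 / a) := mul_nonneg (by linarith) (by positivity)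
      linarith
    -- With `R = 1/a` the inequality reduces to `ζ (1/a - 1) ≤ 0`.
    · nlinarith

theorem hasSum_rhoEigenvalue_mul_laguerreL {a : ℝ} (ha : 0 < a) (ℓ : ℕ) (t : ℝ) :
    HasSum (fun n => rhoEigenvalue a ℓ n * laguerreL n t)
      (Real.exp (-(t * (a - 1) / 2)) * laguerreL ℓ (a * t)) := by
  have hz := abs_zetaOf_lt_one ha
  have h := hasSum_sum (s := Finset.range (ℓ + 1)) fun j _ =>
    (hasSum_omegaWeight_mul_laguerreL j ℓ t hz).mul_left (sigmaWeight j ℓ (zetaOf a))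
  have ha1 : (a + 1) ≠ 0 := by linarith
  have h1 : 1 - zetaOf a = 2 / (a + 1) := by
    rw [zetaOf]
    field_simp
    ring
  have h2 : t * zetaOf a / (1 - zetaOf a) = t * (a - 1) / 2 := by
    rw [h1, zetaOf]
    field_simp
  have h3 : a * t = (1 + zetaOf a) * (t / (1 - zetaOf a)) := by
    rw [h1, zetaOf]
    field_simp
    ring
  -- The `σ` are the weights of the multiplication theorem for `c = 1 + ζ`, with `m = ℓ - j`; hence
  -- the reflection.
  rw [h3, ← laguerreL_mul, ← h2, Finset.mul_sum, ← Finset.sum_range_reflect]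
  refine HasSum.congr_fun (f := fun n => ∑ j ∈ Finset.range (ℓ + 1), sigmaWeight j ℓ (zetaOf a) *
    (omegaWeight n j ℓ (zetaOf a) * laguerreL n t)) ?_ fun n => ?_
  · refine h.congr_value (Finset.sum_congr rfl fun j hj => ?_)
    have hj' : j ≤ ℓ := Nat.lt_succ_iff.1 (Finset.mem_range.1 hj)
    rw [sigmaWeight, show ℓ + 1 - 1 - j = ℓ - j by omega, Nat.sub_sub_self hj',
      Nat.choose_symm hj', show 1 - (1 + zetaOf a) = -zetaOf a by ring]
    ring
  · rw [rhoEigenvalue, Finset.sum_mul]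
    exact Finset.sum_congr rfl fun j _ => by ring

/-! ## The operator `ρ_a^{(ℓ)}` -/

theorem weylExpectation_diagOp {c : ℕ → ℝ} (hc : Summable c) (z : ℂ) :
    weylExpectation (diagOp hermiteBasis c) z = ∑' n, (c n : ℂ) * weylMatrix z n n := by
  rw [weylExpectation, opTrace]
  refine ((isNuclearRep_diagOp hermiteBasis hc).hasSum_trace (onb L2R) (weyl z)).tsum_eq.trans
    (tsum_congr fun n => ?_)
  rw [map_smul, inner_smul_left, inner_smul_right, Complex.conj_ofReal, hermiteBasis_apply,
    ← mul_assoc, ← weylMatrix, ← Complex.ofReal_mul]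
  rcases eq_or_ne (c n) 0 with h | h
  · simp [h]
  · rw [mul_div_cancel₀ _ (Real.sqrt_pos.2 (abs_pos.2 h)).ne']

theorem theorem3p2 (a : ℝ) (ha : 0 < a) (ℓ : ℕ) :
    ∃ ρ : L2R →L[ℂ] L2R,
      IsSelfAdjoint ρ ∧ IsTraceClass ρ ∧
      (∀ z : ℂ,
        weylExpectation ρ z =
            inner ℂ (hermiteVec ℓ) (weyl ((Real.sqrt a : ℂ) * z) (hermiteVec ℓ)) ∧
        weylExpectation ρ z =
            ((laguerreL ℓ (a * ‖z‖ ^ 2 / 2) * Real.exp (-(1 / 4) * a * ‖z‖ ^ 2) : ℝ) : ℂ)) ∧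
      (∀ ρ' : L2R →L[ℂ] L2R, IsSelfAdjoint ρ' → IsTraceClass ρ' →
        (∀ z : ℂ, weylExpectation ρ' z =
          ((laguerreL ℓ (a * ‖z‖ ^ 2 / 2) * Real.exp (-(1 / 4) * a * ‖z‖ ^ 2) : ℝ) : ℂ)) →
        ρ' = ρ) ∧
      (∀ n : ℕ, ρ (hermiteVec n) = (rhoEigenvalue a ℓ n : ℂ) • hermiteVec n) ∧
      (∀ T : L2R →L[ℂ] L2R,
        (∀ n : ℕ, T (hermiteVec n) = (rhoEigenvalue a ℓ n : ℂ) • hermiteVec n) → T = ρ) ∧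
      traceNorm ρ ≤ ENNReal.ofReal (traceNormBound a ℓ) := by
  have hc : Summable (rhoEigenvalue a ℓ) := (summable_abs_rhoEigenvalue ha ℓ).of_abs
  have heig : ∀ n, diagOp hermiteBasis (rhoEigenvalue a ℓ) (hermiteVec n) =
      (rhoEigenvalue a ℓ n : ℂ) • hermiteVec n := fun n => by
    rw [← hermiteBasis_apply, diagOp_apply_basis _ hc]
  have hsa := isSelfAdjoint_diagOp hermiteBasis hc
  have hbound : traceNorm (diagOp hermiteBasis (rhoEigenvalue a ℓ)) ≤
      ENNReal.ofReal (traceNormBound a ℓ) := by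
    rw [traceNorm_diagOp _ hc]
    exact ENNReal.ofReal_le_ofReal (tsum_abs_rhoEigenvalue_le ha ℓ)
  have htc : IsTraceClass (diagOp hermiteBasis (rhoEigenvalue a ℓ)) :=
    hbound.trans_lt ENNReal.ofReal_lt_top
  have hexp : ∀ z : ℂ, weylExpectation (diagOp hermiteBasis (rhoEigenvalue a ℓ)) z =
      ((laguerreL ℓ (a * ‖z‖ ^ 2 / 2) * Real.exp (-(1 / 4) * a * ‖z‖ ^ 2) : ℝ) : ℂ) := by
    intro z
    have h := (hasSum_rhoEigenvalue_mul_laguerreL ha ℓ (‖z‖ ^ 2 / 2)).mul_right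
      (Real.exp (-(1 / 4) * ‖z‖ ^ 2))
    have e : Real.exp (-(‖z‖ ^ 2 / 2 * (a - 1) / 2)) * laguerreL ℓ (a * (‖z‖ ^ 2 / 2)) *
        Real.exp (-(1 / 4) * ‖z‖ ^ 2) =
        laguerreL ℓ (a * ‖z‖ ^ 2 / 2) * Real.exp (-(1 / 4) * a * ‖z‖ ^ 2) := by
      rw [mul_right_comm, ← Real.exp_add, mul_comm]
      congr 2 <;> ring
    rw [weylExpectation_diagOp hc, ← e, ← h.tsum_eq, Complex.ofReal_tsum]
    refine tsum_congr fun n => ?_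
    rw [weylMatrix_diag]
    push_cast
    ring
  have hmat : ∀ z : ℂ, (inner ℂ (hermiteVec ℓ)
      (weyl ((Real.sqrt a : ℂ) * z) (hermiteVec ℓ)) : ℂ) =
      ((laguerreL ℓ (a * ‖z‖ ^ 2 / 2) * Real.exp (-(1 / 4) * a * ‖z‖ ^ 2) : ℝ) : ℂ) := by
    intro z
    have h := weylMatrix_diag ((Real.sqrt a : ℂ) * z) ℓ
    rw [norm_mul, Complex.norm_real, Real.norm_eq_abs, mul_pow, sq_abs, Real.sq_sqrt ha.le,
      ← mul_assoc] at h
    exact h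
  refine ⟨diagOp hermiteBasis (rhoEigenvalue a ℓ), hsa, htc,
    fun z => ⟨(hexp z).trans (hmat z).symm, hexp z⟩, fun ρ' h1 h2 h3 => ?_, heig,
    fun T hT => ?_, hbound⟩
  · exact eq_of_weylExpectation_eq h1 h2 hsa htc fun z => (h3 z).trans (hexp z).symm
  · refine ext_hilbertBasis hermiteBasis fun n => ?_
    rw [hermiteBasis_apply, hT, heig]
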